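/- Let $d\ge 0$, let $\nu$ be a Borel probability measure on $\mathbb R^d$, and let $\eta\sim\nu$ satisfy $\mathbb E|\eta|^2<\infty$; put $m:=\mathbb E[\eta]\in\mathbb R^d$. Trees. For $\rho>0$, the weighted random recursive tree with root weight $\rho$ is the random increasing sequence of rooted trees $(T_n)_{n\ge0}$ where $T_n$ has node set $\{0,1,\dots,n\}$ and root $0$, and where, given $T_0,\dots,T_n$, the tree $T_{n+1}$ is obtained from $T_n$ by adding the node $n+1$ as a child of a random node of $T_n$, which is the root with probability $\rho/(n+\rho)$ and is $v$ with probability $1/(n+\rho)$ for each $v\in\{1,\dots,n\}$. The random recursive tree is defined in the same way, with the parent of $n+1$ uniformly distributed on the $n+1$ nodes of $T_n$ (the case $\rho=1$). Branching random walk. Let $(\eta_v)_{v\ge0}$ be i.i.d. with distribution $\nu$, independent of $(T_n)_{n\ge 0}$. Let $X_0:=0$, and $X_w:=X_v+\eta_w$ whenever $w$ is a child of $v$. The (random) empirical distribution is $$\tilde\mu_n:=\frac1{n+1}\sum_{v=0}^n\delta_{X_v}$$ for the random recursive tree, and $$\tilde\mu_n:=\frac1{n+\rho}\Bigl(\rho\,\delta_{X_0}+\sum_{v=1}^n\delta_{X_v}\Bigr)$$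 for the weighted random recursive tree with root weight $\rho$. For $a>0$, $b\in\mathbb R^d$ and a Borel probability measure $\mu$ on $\mathbb R^d$, let $\Theta_{a,b}(\mu)$ be the distribution of $(X-b)/a$ when $X\sim\mu$. **Theorem 6.1.** For the random recursive tree, almost surely, as $n\to\infty$, $$\Theta_{\sqrt{\log n},\;m\log n}(\tilde\mu_n)\longrightarrow N\bigl(0,\mathbb E[\eta\eta^{\mathsf T}]\bigr)$$ in the space $\mathcal P(\mathbb R^d)$ of Borel probability measures on $\mathbb R^d$ with the weak topology. More generally, the same holds for the weighted random recursive tree with an arbitrary root weight $\rho>0$. -/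

import Mathlib

open MeasureTheory ProbabilityTheory Filter Topology

noncomputable section

namespace RecTree

/-- An increasing sequence of rooted trees `T₀ ⊂ T₁ ⊂ ⋯`, where `Tₙ` has node set `{0, …, n}`
(nodes labelled in order of appearance, the root is `0`) and `Tₙ₊₁` is `Tₙ` with the new node
`n + 1` attached to a node of `Tₙ`. It is given by the parents: `p n ∈ {0, …, n}` is the parent of
the node `n + 1`. The tree `Tₙ` is determined by `p 0, …, p (n - 1)`. -/
abbrev GrowingTree : Type := (n : ℕ) → Fin (n + 1)

/-- The event that the first `n` attachments (that is, the trees `T₀, …, Tₙ`) are those of the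
fixed growing tree `t`. -/
def history {Ω : Type*} (T : Ω → GrowingTree) (t : GrowingTree) (n : ℕ) : Set Ω :=
  {ω | ∀ i < n, T ω i = t i}

/-- Random recursive tree: given `T₀, …, Tₙ`, the parent of the new node `n + 1` is uniformly
distributed on the `n + 1` nodes of `Tₙ`. -/
structure IsRRT {Ω : Type*} [MeasurableSpace Ω] (P : Measure Ω) (T : Ω → GrowingTree) : Prop where
  measurable : Measurable T
  attach : ∀ (t : GrowingTree) (n : ℕ) (k : Fin (n + 1)),
    P.real (history T t n ∩ {ω | T ω n = k}) = P.real (history T t n) * (1 / ((n : ℝ) + 1))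

/-- The root has weight `ρ`, every other node has weight `1`. -/
def nodeWeight (ρ : ℝ) (v : ℕ) : ℝ := if v = 0 then ρ else 1

/-- The total weight `|Tₙ|` of the nodes `0, …, n`. -/
def totalWeight (ρ : ℝ) (n : ℕ) : ℝ := ∑ v ∈ Finset.range (n + 1), nodeWeight ρ v

theorem totalWeight_eq (ρ : ℝ) (n : ℕ) : totalWeight ρ n = n + ρ := by
  simp [totalWeight, Finset.sum_range_succ', nodeWeight]

theorem nodeWeight_nonneg {ρ : ℝ} (hρ : 0 < ρ) (v : ℕ) : 0 ≤ nodeWeight ρ v := by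
  unfold nodeWeight; split_ifs <;> linarith

/-- Weighted random recursive tree with root weight `ρ`: given `T₀, …, Tₙ`, the parent of the new
node `n + 1` is a node of `Tₙ` chosen with probability proportional to its weight. -/
structure IsWeightedRRT {Ω : Type*} [MeasurableSpace Ω] (P : Measure Ω) (ρ : ℝ)
    (T : Ω → GrowingTree) : Prop where
  measurable : Measurable T
  attach : ∀ (t : GrowingTree) (n : ℕ) (k : Fin (n + 1)),
    P.real (history T t n ∩ {ω | T ω n = k}) =
      P.real (history T t n) * (nodeWeight ρ k / totalWeight ρ n)

/-- The positions of the branching walk on the growing tree `p` with offsets `y`: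
`X₀ = 0`, and `X_w = X_v + y_w` if `w` is a child of `v`. The offset `y 0` is not used. -/
def position {E : Type*} [AddMonoid E] (p : GrowingTree) (y : ℕ → E) : ℕ → E
  | 0 => 0
  | n + 1 => position p y (p n) + y (n + 1)
termination_by v => v
decreasing_by exact (p n).isLt

/-- The offsets of a branching random walk on the random growing tree `T`: the `η_v` are i.i.d.
with distribution `ν` and the family `(η_v)` is independent of the tree. -/
structure IsOffsetFamily {Ω E : Type*} [MeasurableSpace Ω] [MeasurableSpace E] (P : Measure Ω)
    (ν : Measure E) (T : Ω → GrowingTree) (η : ℕ → Ω → E) : Prop where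
  measurable : ∀ v, Measurable (η v)
  law : ∀ v, P.map (η v) = ν
  indep : iIndepFun η P
  indep_tree : IndepFun T (fun ω v => η v ω) P

section Empirical

variable {E : Type*} [MeasurableSpace E]

/-- The empirical distribution `(n + 1)⁻¹ ∑_{v ≤ n} δ_{x_v}`. -/
def empirical (x : ℕ → E) (n : ℕ) : ProbabilityMeasure E :=
  ⟨((n : ENNReal) + 1)⁻¹ • ∑ v ∈ Finset.range (n + 1), Measure.dirac (x v), ⟨by
    simp only [Measure.smul_apply, Measure.coe_finsetSum, Finset.sum_apply, measure_univ,
      Finset.sum_const, Finset.card_range, nsmul_eq_mul, mul_one, smul_eq_mul, Nat.cast_add,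
      Nat.cast_one]
    exact ENNReal.inv_mul_cancel (by simp) (by simp)⟩⟩

/-- The weighted empirical distribution `|Tₙ|⁻¹ ∑_{v ≤ n} w_v δ_{x_v}`, with `w₀ = ρ` and
`w_v = 1` for `v ≠ 0`. -/
def weightedEmpirical (ρ : ℝ) (hρ : 0 < ρ) (x : ℕ → E) (n : ℕ) : ProbabilityMeasure E :=
  ⟨(ENNReal.ofReal (totalWeight ρ n))⁻¹ •
      ∑ v ∈ Finset.range (n + 1), ENNReal.ofReal (nodeWeight ρ v) • Measure.dirac (x v), ⟨by
    have h : 0 < totalWeight ρ n := by rw [totalWeight_eq]; positivity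
    simp only [Measure.smul_apply, Measure.coe_finsetSum, Finset.sum_apply, measure_univ,
      smul_eq_mul, mul_one]
    rw [← ENNReal.ofReal_sum_of_nonneg (fun v _ => nodeWeight_nonneg hρ v)]
    exact ENNReal.inv_mul_cancel (by simpa [totalWeight] using h) (by simp)⟩⟩

end Empirical

variable {d : ℕ}

/-- The rescaling map: if `X ∼ μ` then `(X - b) / a ∼ rescale a b μ`. -/
def rescale (a : ℝ) (b : EuclideanSpace ℝ (Fin d))
    (μ : ProbabilityMeasure (EuclideanSpace ℝ (Fin d))) :
    ProbabilityMeasure (EuclideanSpace ℝ (Fin d)) :=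
  μ.map (f := fun x => a⁻¹ • (x - b)) (by fun_prop)

/-- The mean `E[η]` for `η ∼ ν`. -/
def mean (ν : Measure (EuclideanSpace ℝ (Fin d))) : EuclideanSpace ℝ (Fin d) := ∫ x, x ∂ν

/-- The matrix `E[η ηᵀ]` for `η ∼ ν`. -/
def secondMoment (ν : Measure (EuclideanSpace ℝ (Fin d))) : Matrix (Fin d) (Fin d) ℝ :=
  Matrix.of fun i j => ∫ x, x i * x j ∂ν

/-- The normal distribution `N(0, S)` on `ℝᵈ`. -/
def centeredNormal (S : Matrix (Fin d) (Fin d) ℝ) :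
    ProbabilityMeasure (EuclideanSpace ℝ (Fin d)) :=
  ⟨multivariateGaussian 0 S, inferInstance⟩

end RecTree

end

/-! Projecting onto a fixed vector `t` reduces the empirical characteristic function to that of a
real branching walk with offset law `ν`, mean `m` and characteristic function `φ`. Let `S_n(s) = ∑
w_v exp(i s X_v)` be the weighted exponential sum (`expSum`). The parent of the node `n + 1` is
drawn from the weighted empirical distribution, so the conditional mean of the new term is `φ(s)
S_n(s) / (n + ρ)`. Hence `M_n(s) = C_n(s) S_n(s)` is a martingale in `n`, where `C_n(s)` is the
inverse of `∏_{k<n} (1 + φ(s)/(k+ρ))` (`normalizer`), and `M_n(0) = ρ` for every `n`.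

The limit theorem evaluates `S_n` at the moving argument `s_n = (log n)^(-1/2)`, so control of `M_n`
near `0` uniform in `n` is needed. It comes from the derivative `D_n = ∂M_n/∂s` (`derivMartingale`),
again a martingale in `n`. Near the origin `Re φ ≥ 3/4`, which makes `|C_n|²` of order at most
`n^(-3/2)`. The centered increments of `S_n` and of its derivative grow in mean square at most like
`n^(1/4)`. The increments of `D_n` are orthogonal, so `D_n(s)` is bounded in `L²`, uniformly in `n`
and in `s ∈ [0, δ]`. Therefore `∫_0^δ |D_n(s)|² ds` is a submartingale bounded in `L¹`, hence almost
surely bounded in `n` (`ae_bddAbove_squareFunction`). Integrating `D_n` from `0` to `s_n` shows that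
`M_n(s_n) - ρ` is almost surely `O(√s_n)` (`norm_normalizer_mul_expSum_sub_le`).

What remains is deterministic: `ρ / ((n+ρ) C_n(s_n))` is asymptotic to `exp((φ(s_n) - 1) log n)`,
and the second order expansion of `φ` at `0` yields the phase `exp(i m √(log n))`, cancelled by the
centering, times the Gaussian factor (`tendsto_normalizer_inv_sqrt_log`).

The exceptional null set depends on `t`. Fubini gives, almost surely, convergence for almost every
`t`; Krein's inequality upgrades this to every `t` (`tendsto_charFun_of_ae`), and Lévy's continuity
theorem concludes. -/

open MeasureTheory ProbabilityTheory Filter Topology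

noncomputable section

namespace RecTree

/-! ### Independence of the new node from the past, and averaging over it -/

section Independence

variable {Ω : Type*} [MeasurableSpace Ω] {P : Measure Ω}

/-- If the pairs `(X₁, X₂)` and `(Y₁, Y₂)` are independent of each other and have independent
entries, then `(X₁, Y₁)` and `(X₂, Y₂)` are independent. -/
theorem indepFun_prodMk_swap [IsProbabilityMeasure P] {α₁ α₂ β₁ β₂ : Type*}
    [MeasurableSpace α₁] [MeasurableSpace α₂] [MeasurableSpace β₁] [MeasurableSpace β₂]
    {X₁ : Ω → α₁} {X₂ : Ω → α₂} {Y₁ : Ω → β₁} {Y₂ : Ω → β₂}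
    (hX₁ : Measurable X₁) (hX₂ : Measurable X₂) (hY₁ : Measurable Y₁) (hY₂ : Measurable Y₂)
    (hX : IndepFun X₁ X₂ P) (hY : IndepFun Y₁ Y₂ P)
    (hXY : IndepFun (fun ω => (X₁ ω, X₂ ω)) (fun ω => (Y₁ ω, Y₂ ω)) P) :
    IndepFun (fun ω => (X₁ ω, Y₁ ω)) (fun ω => (X₂ ω, Y₂ ω)) P := by
  -- Rectangles form a generating π-system on each side, and on rectangles all four variables
  -- factorize.
  have key : ∀ (a₁ : Set α₁) (a₂ : Set α₂) (b₁ : Set β₁) (b₂ : Set β₂), MeasurableSet a₁ →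
      MeasurableSet a₂ → MeasurableSet b₁ → MeasurableSet b₂ →
      P ((X₁ ⁻¹' a₁ ∩ X₂ ⁻¹' a₂) ∩ (Y₁ ⁻¹' b₁ ∩ Y₂ ⁻¹' b₂)) =
        (P (X₁ ⁻¹' a₁) * P (X₂ ⁻¹' a₂)) * (P (Y₁ ⁻¹' b₁) * P (Y₂ ⁻¹' b₂)) := by
    intro a₁ a₂ b₁ b₂ h1 h2 h3 h4
    have := hXY.measure_inter_preimage_eq_mul (a₁ ×ˢ a₂) (b₁ ×ˢ b₂) (h1.prod h2) (h3.prod h4)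
    rw [← hX.measure_inter_preimage_eq_mul _ _ h1 h2, ← hY.measure_inter_preimage_eq_mul _ _ h3 h4]
    exact this
  have key1 : ∀ (a₁ : Set α₁) (b₁ : Set β₁), MeasurableSet a₁ → MeasurableSet b₁ →
      P (X₁ ⁻¹' a₁ ∩ Y₁ ⁻¹' b₁) = P (X₁ ⁻¹' a₁) * P (Y₁ ⁻¹' b₁) := by
    intro a₁ b₁ h1 h3
    simpa using key a₁ Set.univ b₁ Set.univ h1 .univ h3 .univ
  have key2 : ∀ (a₂ : Set α₂) (b₂ : Set β₂), MeasurableSet a₂ → MeasurableSet b₂ →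
      P (X₂ ⁻¹' a₂ ∩ Y₂ ⁻¹' b₂) = P (X₂ ⁻¹' a₂) * P (Y₂ ⁻¹' b₂) := by
    intro a₂ b₂ h2 h4
    simpa using key Set.univ a₂ Set.univ b₂ .univ h2 .univ h4
  have hm1 : Measurable fun ω => (X₁ ω, Y₁ ω) := hX₁.prodMk hY₁
  have hm2 : Measurable fun ω => (X₂ ω, Y₂ ω) := hX₂.prodMk hY₂
  refine IndepSets.indep
    (p1 := Set.preimage (fun ω => (X₁ ω, Y₁ ω)) ''
      Set.image2 (· ×ˢ ·) {s | MeasurableSet s} {t | MeasurableSet t})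
    (p2 := Set.preimage (fun ω => (X₂ ω, Y₂ ω)) ''
      Set.image2 (· ×ˢ ·) {s | MeasurableSet s} {t | MeasurableSet t})
    hm1.comap_le hm2.comap_le (isPiSystem_prod.comap _) (isPiSystem_prod.comap _) ?_ ?_ ?_
  · rw [← generateFrom_prod, MeasurableSpace.comap_generateFrom]
  · rw [← generateFrom_prod, MeasurableSpace.comap_generateFrom]
  · rw [IndepSets_iff]
    rintro _ _ ⟨_, ⟨a₁, h1, b₁, h3, rfl⟩, rfl⟩ ⟨_, ⟨a₂, h2, b₂, h4, rfl⟩, rfl⟩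
    rw [Set.mem_ofPred_eq] at h1 h2 h3 h4
    have e1 : (fun ω => (X₁ ω, Y₁ ω)) ⁻¹' a₁ ×ˢ b₁ = X₁ ⁻¹' a₁ ∩ Y₁ ⁻¹' b₁ := rfl
    have e2 : (fun ω => (X₂ ω, Y₂ ω)) ⁻¹' a₂ ×ˢ b₂ = X₂ ⁻¹' a₂ ∩ Y₂ ⁻¹' b₂ := rfl
    rw [e1, e2, key1 _ _ h1 h3, key2 _ _ h2 h4, Set.inter_inter_inter_comm,
      key _ _ _ _ h1 h2 h3 h4]
    ring

/-- The first `n` attachments of a random growing tree. -/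
def attachments (T : Ω → GrowingTree) (n : ℕ) (ω : Ω) : (i : Fin n) → Fin ((i : ℕ) + 1) :=
  fun i => T ω i

/-- The offsets of the nodes `0, …, n`. -/
def offsets (y : ℕ → Ω → ℝ) (n : ℕ) (ω : Ω) : Fin (n + 1) → ℝ := fun i => y i ω

variable {ρ : ℝ} {T : Ω → GrowingTree} {ν : Measure ℝ} {y : ℕ → Ω → ℝ}

theorem measurable_attachments (hT : Measurable T) (n : ℕ) : Measurable (attachments T n) := by
  unfold attachments
  fun_prop

theorem measurable_offsets (hy : ∀ v, Measurable (y v)) (n : ℕ) : Measurable (offsets y n) := by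
  unfold offsets
  fun_prop

theorem totalWeight_pos (hρ : 0 < ρ) (n : ℕ) : 0 < totalWeight ρ n := by
  rw [totalWeight_eq]; positivity

/-- The value `0` after time `n` is arbitrary: `history` reads only the first `n` attachments. -/
theorem attachments_preimage_singleton {Ω : Type*} (T : Ω → GrowingTree) (n : ℕ)
    (t : (i : Fin n) → Fin ((i : ℕ) + 1)) :
    attachments T n ⁻¹' {t} =
      history T (fun i => if h : i < n then t ⟨i, h⟩ else 0) n := by
  ext ω
  simp only [Set.mem_preimage, Set.mem_singleton_iff, history, Set.mem_ofPred_eq]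
  constructor
  · intro h i hi
    simp [hi, ← h, attachments]
  · intro h
    funext i
    simpa [attachments] using h i i.isLt

namespace IsWeightedRRT

/-- The attachment rule is given for single histories. There are finitely many of length `n`, so it
passes to any event of the past by summation. -/
theorem measureReal_attachments_inter [IsProbabilityMeasure P] (hT : IsWeightedRRT P ρ T) (n : ℕ)
    (s : Set ((i : Fin n) → Fin ((i : ℕ) + 1))) (k : Fin (n + 1)) :
    P.real (attachments T n ⁻¹' s ∩ {ω | T ω n = k}) =
      P.real (attachments T n ⁻¹' s) * (nodeWeight ρ k / totalWeight ρ n) := by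
  classical
  have hTm := hT.measurable
  have hm := measurable_attachments hTm n
  have hk : MeasurableSet {ω | T ω n = k} :=
    (show Measurable fun ω => T ω n by fun_prop) (measurableSet_singleton k)
  have hs : s = ⋃ t ∈ s.toFinset, {t} := by ext; simp
  have hd : Set.PairwiseDisjoint (s.toFinset : Set ((i : Fin n) → Fin ((i : ℕ) + 1)))
      (fun t => attachments T n ⁻¹' {t}) := fun a _ b _ hab =>
    Disjoint.preimage _ (by simpa using hab)
  rw [hs]
  simp only [Set.preimage_iUnion, Set.iUnion_inter]
  rw [measureReal_biUnion_finset hd fun t _ => hm (measurableSet_singleton t),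
    measureReal_biUnion_finset (fun a ha b hb hab =>
      (hd ha hb hab).mono Set.inter_subset_left Set.inter_subset_left)
      fun t _ => (hm (measurableSet_singleton t)).inter hk, Finset.sum_mul]
  refine Finset.sum_congr rfl fun t _ => ?_
  rw [attachments_preimage_singleton]
  exact hT.attach _ n k

theorem measureReal_parent [IsProbabilityMeasure P] (hT : IsWeightedRRT P ρ T) (n : ℕ)
    (k : Fin (n + 1)) :
    P.real {ω | T ω n = k} = nodeWeight ρ k / totalWeight ρ n := by
  simpa using hT.measureReal_attachments_inter n Set.univ k

theorem indepFun_attachments [IsProbabilityMeasure P] (hT : IsWeightedRRT P ρ T) (n : ℕ) :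
    IndepFun (attachments T n) (fun ω => T ω n) P := by
  classical
  have hTm := hT.measurable
  have hm := measurable_attachments hTm n
  have hn : Measurable fun ω => T ω n := by fun_prop
  have key (s : Set ((i : Fin n) → Fin ((i : ℕ) + 1))) (u : Set (Fin (n + 1))) :
      P.real (attachments T n ⁻¹' s ∩ (fun ω => T ω n) ⁻¹' u) =
        P.real (attachments T n ⁻¹' s) * P.real ((fun ω => T ω n) ⁻¹' u) := by
    have hu : u = ⋃ t ∈ u.toFinset, {t} := by ext; simp
    have hd : Set.PairwiseDisjoint (u.toFinset : Set (Fin (n + 1)))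
        (fun t => (fun ω => T ω n) ⁻¹' {t}) := fun a _ b _ hab =>
      Disjoint.preimage _ (by simpa using hab)
    rw [hu]
    simp only [Set.preimage_iUnion, Set.inter_iUnion]
    rw [measureReal_biUnion_finset hd fun t _ => hn (measurableSet_singleton t),
      measureReal_biUnion_finset (fun a ha b hb hab =>
        (hd ha hb hab).mono Set.inter_subset_right Set.inter_subset_right)
        fun t _ => (hm (Set.toFinite s).measurableSet).inter (hn (measurableSet_singleton t)),
      Finset.mul_sum]
    refine Finset.sum_congr rfl fun k _ => ?_
    exact (hT.measureReal_attachments_inter n s k).trans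
      (congrArg _ (hT.measureReal_parent n k).symm)
  rw [indepFun_iff_measure_inter_preimage_eq_mul]
  intro s u _ _
  have := key s u
  rw [Measure.real, Measure.real, Measure.real, ← ENNReal.toReal_mul,
    ENNReal.toReal_eq_toReal_iff' (by finiteness) (by finiteness)] at this
  exact this

end IsWeightedRRT

theorem IsOffsetFamily.indepFun_offsets (hy : IsOffsetFamily P ν T y) (n : ℕ) :
    IndepFun (offsets y n) (y (n + 1)) P := by
  have h := hy.indep.indepFun_finset (Finset.range (n + 1)) {n + 1} (by simp) hy.measurable
  exact h.comp 
    (φ := fun (f : Finset.range (n + 1) → ℝ) (i : Fin (n + 1)) => f ⟨i, by simp; omega⟩)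
    (ψ := fun (f : ({n + 1} : Finset ℕ) → ℝ) => f ⟨n + 1, by simp⟩)
    (by fun_prop) (by fun_prop)

/-- The tree `Tₙ` together with the offsets of its nodes. -/
def past (T : Ω → GrowingTree) (y : ℕ → Ω → ℝ) (n : ℕ) (ω : Ω) :
    ((i : Fin n) → Fin ((i : ℕ) + 1)) × (Fin (n + 1) → ℝ) :=
  (attachments T n ω, offsets y n ω)

theorem measurable_past (hT : Measurable T) (hy : ∀ v, Measurable (y v)) (n : ℕ) :
    Measurable (past T y n) :=
  (measurable_attachments hT n).prodMk (measurable_offsets hy n)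

/-- The hypotheses separate trees from offsets, while the martingale argument separates past from
future. The regrouping is legitimate because each of the two sources splits independently into past
and future. -/
theorem indepFun_past [IsProbabilityMeasure P] (hT : IsWeightedRRT P ρ T)
    (hy : IsOffsetFamily P ν T y) (n : ℕ) :
    IndepFun (past T y n) (fun ω => (T ω n, y (n + 1) ω)) P := by
  have hTm := hT.measurable
  have hym := hy.measurable
  refine indepFun_prodMk_swap (measurable_attachments hTm n) (by fun_prop)
    (measurable_offsets hym n) (hym _) (hT.indepFun_attachments n) (hy.indepFun_offsets n) ?_
  exact hy.indep_tree.comp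
    (φ := fun t : GrowingTree => ((fun i : Fin n => t i : (i : Fin n) → Fin ((i : ℕ) + 1)), t n))
    (ψ := fun f : ℕ → ℝ => ((fun i : Fin (n + 1) => f i), f (n + 1)))
    (by fun_prop) (by fun_prop)

theorem indepFun_parent_offset (hy : IsOffsetFamily P ν T y) (n : ℕ) :
    IndepFun (fun ω => T ω n) (y (n + 1)) P :=
  hy.indep_tree.comp (φ := fun t : GrowingTree => t n) (ψ := fun f : ℕ → ℝ => f (n + 1))
    (by fun_prop) (by fun_prop)

/-- The filtration generated by the trees and the offsets of their nodes. -/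
def treeFiltration (hT : Measurable T) (hy : ∀ v, Measurable (y v)) :
    Filtration ℕ ‹MeasurableSpace Ω› where
  seq n := MeasurableSpace.comap (past T y n) inferInstance
  mono' := by
    refine monotone_nat_of_le_succ fun n => ?_
    have h : past T y n = (fun p : ((i : Fin (n + 1)) → Fin ((i : ℕ) + 1)) × (Fin (n + 2) → ℝ) =>
        ((fun i : Fin n => p.1 i.castSucc : (i : Fin n) → Fin ((i : ℕ) + 1)),
          fun i : Fin (n + 1) => p.2 i.castSucc)) ∘ past T y (n + 1) := by
      rfl
    rw [h, ← MeasurableSpace.comap_comp]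
    exact MeasurableSpace.comap_mono (Measurable.comap_le (by fun_prop))
  le' n := (measurable_past hT hy n).comap_le

theorem measurable_parent_treeFiltration (hT : Measurable T) (hy : ∀ v, Measurable (y v))
    {i n : ℕ} (h : i < n) : Measurable[treeFiltration hT hy n] fun ω => T ω i :=
  Measurable.comp (g := fun p : ((i : Fin n) → Fin ((i : ℕ) + 1)) × (Fin (n + 1) → ℝ) =>
    p.1 ⟨i, h⟩) (by fun_prop) (comap_measurable (past T y n))

theorem measurable_offset_treeFiltration (hT : Measurable T) (hy : ∀ v, Measurable (y v))
    {i n : ℕ} (h : i ≤ n) : Measurable[treeFiltration hT hy n] (y i) :=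
  Measurable.comp (g := fun p : ((i : Fin n) → Fin ((i : ℕ) + 1)) × (Fin (n + 1) → ℝ) =>
    p.2 ⟨i, by omega⟩) (by fun_prop) (comap_measurable (past T y n))

/-- Averaging over the new node `n + 1`: its parent is chosen according to the node weights and its
offset has distribution `ν`, independently of the past. -/
theorem integral_newNode [IsProbabilityMeasure P] {𝕜 : Type*} [RCLike 𝕜] (hT : IsWeightedRRT P ρ T)
    (hy : IsOffsetFamily P ν T y) (n : ℕ) {f : ℕ → Ω → 𝕜}
    (hf : ∀ k ≤ n, Measurable[treeFiltration hT.measurable hy.measurable n] (f k))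
    (hfi : ∀ k ≤ n, Integrable (f k) P) {h : ℝ → 𝕜} (hh : Measurable h) (hhi : Integrable h ν) :
    Integrable (fun ω => f (T ω n) ω * h (y (n + 1) ω)) P ∧
    ∫ ω, f (T ω n) ω * h (y (n + 1) ω) ∂P =
      (∑ k ∈ Finset.range (n + 1), (nodeWeight ρ k : 𝕜) * ∫ ω, f k ω ∂P) / (totalWeight ρ n : 𝕜)
        * ∫ x, h x ∂ν := by
  classical
  have hTm := hT.measurable
  have hym := hy.measurable (n + 1)
  have hn : Measurable fun ω => T ω n := by fun_prop
  -- The indicators of the possible parents turn the random index `T ω n` into a finite sum, each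
  -- term of which is a product of three factors: one from the past, one from the parent, one from
  -- the new offset.
  let e : Fin (n + 1) → Ω → 𝕜 := fun k ω => if T ω n = k then 1 else 0
  have he (k) : Measurable (e k) :=
    Measurable.ite (hn (measurableSet_singleton k)) measurable_const measurable_const
  have hei (k) : Integrable (e k) P :=
    Integrable.of_bound (he k).aestronglyMeasurable 1 (.of_forall fun ω => by
      simp only [e]; split_ifs <;> simp)
  have hhy : Measurable fun ω => h (y (n + 1) ω) := hh.comp hym
  have hhyi : Integrable (fun ω => h (y (n + 1) ω)) P := by
    have := hhi
    rw [← hy.law (n + 1)] at this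
    exact this.comp_measurable hym
  have hhyint : ∫ ω, h (y (n + 1) ω) ∂P = ∫ x, h x ∂ν := by
    rw [← hy.law (n + 1), integral_map hym.aemeasurable hh.aestronglyMeasurable]
  have heint (k : Fin (n + 1)) : ∫ ω, e k ω ∂P = (nodeWeight ρ k : 𝕜) / (totalWeight ρ n : 𝕜) := by
    have : e k = Set.indicator {ω | T ω n = k} fun _ => 1 := by
      ext ω; simp [e, Set.indicator_apply]
    have hk : MeasurableSet {ω | T ω n = k} := hn (measurableSet_singleton k)
    rw [this, integral_indicator_const _ hk,
      hT.measureReal_parent n k]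
    simp [RCLike.real_smul_eq_coe_mul]
  have hind1 (k : Fin (n + 1)) : IndepFun (e k) (fun ω => h (y (n + 1) ω)) P :=
    (indepFun_parent_offset hy n).comp (φ := fun j : Fin (n + 1) => if j = k then (1 : 𝕜) else 0)
      (by fun_prop) hh
  have hind2 (k : Fin (n + 1)) :
      IndepFun (f k) (fun ω => e k ω * h (y (n + 1) ω)) P := by
    have h1 : IndepFun (past T y n) (fun ω => e k ω * h (y (n + 1) ω)) P :=
      (indepFun_past hT hy n).comp (φ := id)
        (ψ := fun p : Fin (n + 1) × ℝ => (if p.1 = k then (1 : 𝕜) else 0) * h p.2)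
        measurable_id
        (((by fun_prop : Measurable fun j : Fin (n + 1) => if j = k then (1 : 𝕜) else 0).comp
          measurable_fst).mul (hh.comp measurable_snd))
    exact indep_of_indep_of_le_left h1 (hf k (by omega)).comap_le
  have hfm (k : Fin (n + 1)) : AEStronglyMeasurable (f k) P := (hfi k (by omega)).1
  have hdec : (fun ω => f (T ω n) ω * h (y (n + 1) ω)) =
      fun ω => ∑ k : Fin (n + 1), f k ω * (e k ω * h (y (n + 1) ω)) := by
    ext ω
    rw [Finset.sum_eq_single (T ω n)]
    · simp [e]
    · intro b _ hb
      simp [e, hb.symm]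
    · simp
  have hint (k : Fin (n + 1)) : Integrable (fun ω => f k ω * (e k ω * h (y (n + 1) ω))) P :=
    (hind2 k).integrable_mul (hfi k (by omega)) ((hind1 k).integrable_mul (hei k) hhyi)
  rw [hdec]
  refine ⟨integrable_finsetSum _ fun k _ => hint k, ?_⟩
  rw [integral_finsetSum _ fun k _ => hint k]
  have h3 (k : Fin (n + 1)) : ∫ ω, f k ω * (e k ω * h (y (n + 1) ω)) ∂P =
      (nodeWeight ρ k : 𝕜) * (∫ ω, f k ω ∂P) / (totalWeight ρ n : 𝕜) * ∫ x, h x ∂ν := by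
    rw [(hind2 k).integral_fun_mul_eq_mul_integral (hfm k)
      ((he k).mul hhy).aestronglyMeasurable,
      (hind1 k).integral_fun_mul_eq_mul_integral (he k).aestronglyMeasurable
      hhy.aestronglyMeasurable, heint, hhyint]
    ring
  rw [Finset.sum_congr rfl fun k _ => h3 k, ← Finset.sum_mul, ← Finset.sum_div,
    Fin.sum_univ_eq_sum_range (fun k => (nodeWeight ρ k : 𝕜) * ∫ ω, f k ω ∂P)]

end Independence

/-! ### Polynomial bounds for linear recursions -/

section Growth

variable {ρ : ℝ}

/-- Exponentiate `1 / (x + 1) ≤ log ((x + 1) / x)`. -/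
theorem one_add_div_le_rpow {x ε : ℝ} (hx : 0 < x) (hε : 0 ≤ ε) :
    1 + ε / (x + 1) ≤ ((x + 1) / x) ^ ε := by
  have h1 : 0 < (x + 1) / x := by positivity
  have h2 : 1 / (x + 1) ≤ Real.log ((x + 1) / x) := by
    refine le_trans (le_of_eq ?_) (Real.one_sub_inv_le_log_of_pos h1)
    field_simp
    ring
  calc 1 + ε / (x + 1) ≤ Real.exp (ε / (x + 1)) := by
        rw [add_comm]; exact Real.add_one_le_exp _
    _ ≤ Real.exp (Real.log ((x + 1) / x) * ε) := by
        refine Real.exp_le_exp.2 ?_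
        rw [div_eq_mul_one_div, mul_comm]
        gcongr
    _ = _ := (Real.rpow_def_of_pos h1 ε).symm

/-- A discrete Gronwall inequality with polynomial growth. -/
theorem le_rpow_of_le_mul_add (hρ : 0 < ρ) {ε c : ℝ} (hε : 0 < ε) (hc : 0 ≤ c) {b : ℕ → ℝ}
    (hb0 : 0 ≤ b 0)
    (hb : ∀ n : ℕ, b (n + 1) ≤ b n * (1 + ε / (n + ρ + 1)) + c / (n + ρ + 1)) (n : ℕ) :
    b n ≤ (b 0 + c / ε) * ((n + ρ) / ρ) ^ ε := by
  -- The shift by `c / ε` makes the recursion homogeneous.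
  have key : b n + c / ε ≤ (b 0 + c / ε) * ((n + ρ) / ρ) ^ ε := by
    induction n with
    | zero => simp [hρ.ne']
    | succ n ih =>
      have hx : 0 < (n : ℝ) + ρ := by positivity
      calc b (n + 1) + c / ε
          ≤ b n * (1 + ε / (n + ρ + 1)) + c / (n + ρ + 1) + c / ε := by linarith [hb n]
        _ = (b n + c / ε) * (1 + ε / (n + ρ + 1)) := by field_simp; ring
        _ ≤ ((b 0 + c / ε) * ((n + ρ) / ρ) ^ ε) * ((n + ρ + 1) / (n + ρ)) ^ ε := by
            have h0 : 0 ≤ b 0 + c / ε := by positivity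
            gcongr
            exact one_add_div_le_rpow hx hε.le
        _ = _ := by
            rw [mul_assoc, ← Real.mul_rpow (by positivity) (by positivity)]
            congr 2
            push_cast
            field_simp
            ring
  have : 0 ≤ c / ε := by positivity
  linarith

theorem inv_le_mul_inv_succ (hρ : 0 < ρ) (n : ℕ) :
    1 / ((n : ℝ) + ρ) ≤ (1 + 1 / ρ) / (n + ρ + 1) := by
  rw [div_le_div_iff₀ (by positivity) (by positivity)]
  have : (1 : ℝ) ≤ (n + ρ) / ρ := by rw [le_div_iff₀ hρ]; simp
  calc 1 * ((n : ℝ) + ρ + 1) ≤ n + ρ + (n + ρ) / ρ := by linarith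
    _ = _ := by ring

end Growth

/-! ### The martingale normalizer and its logarithmic derivative -/

section Normalizer

/-- The factor that turns `∑ w_v exp (i s x_v)` into a martingale; `q` is the value of the
characteristic function of the offsets. -/
def normalizer (ρ : ℝ) (q : ℂ) (n : ℕ) : ℂ := (∏ k ∈ Finset.range n, (1 + q / ((k : ℂ) + ρ)))⁻¹

/-- The negative logarithmic derivative of the normalizer, for a characteristic function with
value `q` and derivative `q'`. -/
def logDerivative (ρ : ℝ) (q q' : ℂ) (n : ℕ) : ℂ :=
  ∑ k ∈ Finset.range n, q' / ((k : ℂ) + ρ + q)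

variable {ρ : ℝ} {q q' : ℂ}

theorem re_factor (n : ℕ) : (1 + q / ((n : ℂ) + ρ)).re = 1 + q.re / (n + ρ) := by
  have : q / ((n : ℂ) + ρ) = q / ((n + ρ : ℝ) : ℂ) := by push_cast; rfl
  rw [this, Complex.add_re, Complex.div_ofReal_re, Complex.one_re]

/-- The real part of each factor is at least `1`. -/
theorem factor_ne_zero (hρ : 0 < ρ) (hq : 0 ≤ q.re) (n : ℕ) : 1 + q / ((n : ℂ) + ρ) ≠ 0 := by
  intro h
  have h1 := re_factor (ρ := ρ) (q := q) n
  rw [h, Complex.zero_re] at h1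
  have : 0 ≤ q.re / (n + ρ) := by positivity
  linarith

theorem natCast_add_ne_zero (hρ : 0 < ρ) (n : ℕ) : (n : ℂ) + ρ ≠ 0 := by
  have : (n : ℂ) + ρ = ((n + ρ : ℝ) : ℂ) := by push_cast; rfl
  rw [this, Complex.ofReal_ne_zero]
  positivity

theorem natCast_add_add_ne_zero (hρ : 0 < ρ) (hq : 0 ≤ q.re) (n : ℕ) : (n : ℂ) + ρ + q ≠ 0 := by
  have h := mul_ne_zero (natCast_add_ne_zero hρ n) (factor_ne_zero hρ hq n)
  rwa [mul_add, mul_one, mul_div_cancel₀ _ (natCast_add_ne_zero hρ n)] at h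

theorem normalizer_succ (hρ : 0 < ρ) (hq : 0 ≤ q.re) (n : ℕ) :
    normalizer ρ q n = normalizer ρ q (n + 1) * (1 + q / ((n : ℂ) + ρ)) := by
  have := factor_ne_zero hρ hq n
  rw [normalizer, normalizer, Finset.prod_range_succ, mul_inv, mul_assoc, inv_mul_cancel₀ this,
    mul_one]

theorem logDerivative_succ (n : ℕ) :
    logDerivative ρ q q' (n + 1) = logDerivative ρ q q' n + q' / ((n : ℂ) + ρ + q) := by
  rw [logDerivative, logDerivative, Finset.sum_range_succ]

/-- By Bernoulli's inequality `(1 + u)^(3/4) ≤ 1 + 3u/4` with `u = 1/(n + ρ)`, and the right side is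
at most the real part of the corresponding factor. The powers of `1 + u` telescope. -/
theorem norm_normalizer_le (hρ : 0 < ρ) (hq : 3 / 4 ≤ q.re) (n : ℕ) :
    ‖normalizer ρ q n‖ ≤ (((n : ℝ) + ρ) / ρ) ^ (-(3 / 4) : ℝ) := by
  rw [normalizer, norm_inv, Real.rpow_neg (by positivity)]
  refine inv_anti₀ (by positivity) ?_
  induction n with
  | zero => simp [hρ.ne']
  | succ n ih =>
    have hx : 0 < (n : ℝ) + ρ := by positivity
    rw [Finset.prod_range_succ, norm_mul]
    have h1 : ((↑(n + 1) + ρ) / ρ : ℝ) = (n + ρ) / ρ * (1 + 1 / (n + ρ)) := by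
      push_cast; field_simp; ring
    rw [h1, Real.mul_rpow (by positivity) (by positivity)]
    refine mul_le_mul ih ?_ (by positivity) (by positivity)
    calc (1 + 1 / ((n : ℝ) + ρ)) ^ (3 / 4 : ℝ) ≤ 1 + 3 / 4 * (1 / ((n : ℝ) + ρ)) :=
          rpow_one_add_le_one_add_mul_self (by
            have : 0 < 1 / ((n : ℝ) + ρ) := by positivity
            linarith) (by norm_num) (by norm_num)
      _ ≤ 1 + q.re / (n + ρ) := by
          rw [mul_one_div]
          gcongr
      _ = (1 + q / ((n : ℂ) + ρ)).re := (re_factor n).symm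
      _ ≤ _ := Complex.re_le_norm _

/-- The terms are of size `‖q'‖ / (n + ρ)`, so the growth is in fact logarithmic. The exponent `1/8`
is chosen so that the square grows like the power `1/4`, the same rate as the second moments of the
walk. -/
theorem norm_logDerivative_le (hρ : 0 < ρ) (hq : 0 ≤ q.re) (n : ℕ) :
    ‖logDerivative ρ q q' n‖ ≤ 8 * (1 + 1 / ρ) * ‖q'‖ * (((n : ℝ) + ρ) / ρ) ^ (1 / 8 : ℝ) := by
  have h := le_rpow_of_le_mul_add (b := fun n => ‖logDerivative ρ q q' n‖) hρ
    (ε := 1 / 8) (c := (1 + 1 / ρ) * ‖q'‖) (by norm_num) (by positivity) (by simp) (fun n => ?_) n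
  · refine h.trans (le_of_eq ?_)
    rw [show logDerivative ρ q q' 0 = 0 by simp [logDerivative], norm_zero]
    ring
  · rw [logDerivative_succ]
    refine (norm_add_le _ _).trans ?_
    have h1 : ‖q' / ((n : ℂ) + ρ + q)‖ ≤ (1 + 1 / ρ) * ‖q'‖ / (n + ρ + 1) := by
      rw [norm_div, div_eq_mul_one_div, mul_comm (1 + 1 / ρ), mul_div_assoc]
      refine mul_le_mul_of_nonneg_left ?_ (norm_nonneg _)
      refine le_trans ?_ (inv_le_mul_inv_succ hρ n)
      refine one_div_le_one_div_of_le (by positivity) ?_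
      calc (n : ℝ) + ρ ≤ ((n : ℂ) + ρ + q).re := by simp [hq]
        _ ≤ _ := Complex.re_le_norm _
    have h2 : ‖logDerivative ρ q q' n‖ ≤ ‖logDerivative ρ q q' n‖ * (1 + 1 / 8 / (n + ρ + 1)) :=
      le_mul_of_one_le_right (norm_nonneg _) (by
        have : 0 ≤ 1 / 8 / ((n : ℝ) + ρ + 1) := by positivity
        linarith)
    linarith

theorem hasDerivAt_normalizer {φ φ' : ℝ → ℂ} {s : ℝ} (hρ : 0 < ρ) (hφ : HasDerivAt φ (φ' s) s)
    (hq : 0 ≤ (φ s).re) (n : ℕ) :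
    HasDerivAt (fun t => normalizer ρ (φ t) n)
      (-(normalizer ρ (φ s) n * logDerivative ρ (φ s) (φ' s) n)) s := by
  induction n with
  | zero => simpa [normalizer, logDerivative] using hasDerivAt_const s (1 : ℂ)
  | succ n ih =>
    have h0 := factor_ne_zero hρ hq n
    have h1 := natCast_add_ne_zero hρ n
    have h2 := natCast_add_add_ne_zero hρ hq n
    have hf : HasDerivAt (fun t => (1 + φ t / ((n : ℂ) + ρ))⁻¹)
        (-(φ' s / ((n : ℂ) + ρ)) / (1 + φ s / ((n : ℂ) + ρ)) ^ 2) s :=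
      ((hφ.div_const _).const_add 1).inv h0
    have h := ih.mul hf
    have e : (fun t => normalizer ρ (φ t) (n + 1)) =
        (fun t => normalizer ρ (φ t) n) * fun t => (1 + φ t / ((n : ℂ) + ρ))⁻¹ := by
      ext t
      simp only [Pi.mul_apply, normalizer]
      rw [Finset.prod_range_succ, mul_inv]
    rw [e]
    refine h.congr_deriv ?_
    rw [logDerivative_succ, normalizer_succ hρ hq n]
    have h3 : 1 + φ s / ((n : ℂ) + ρ) = ((n : ℂ) + ρ + φ s) / ((n : ℂ) + ρ) := by field_simp
    rw [h3]
    field_simp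
    ring

end Normalizer

/-! ### Asymptotics of the normalizer -/

section Asymptotics

variable {ρ : ℝ}

/-- The two bounds `1 - 1/x ≤ log x ≤ x - 1`, applied to ratios of consecutive terms, telescope to
logarithms on both sides of the sum. -/
theorem abs_sum_inv_sub_log_le (hρ : 0 < ρ) {n : ℕ} (hn : 1 ≤ n) :
    |∑ k ∈ Finset.range n, 1 / ((k : ℝ) + ρ + 1) - Real.log n| ≤
      |Real.log (1 + ρ)| + |Real.log ρ| := by
  have hup : ∀ n : ℕ, ∑ k ∈ Finset.range n, 1 / ((k : ℝ) + ρ + 1) ≤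
      Real.log (n + ρ) - Real.log ρ := by
    intro n
    induction n with
    | zero => simp
    | succ n ih =>
      have hx : 0 < (n : ℝ) + ρ := by positivity
      rw [Finset.sum_range_succ]
      have h := Real.one_sub_inv_le_log_of_pos (x := ((n : ℝ) + ρ + 1) / (n + ρ)) (by positivity)
      rw [Real.log_div (by positivity) (by positivity)] at h
      have h3 : 1 / ((n : ℝ) + ρ + 1) = 1 - (((n : ℝ) + ρ + 1) / (n + ρ))⁻¹ := by field_simp; ring
      have h4 : ((n + 1 : ℕ) : ℝ) + ρ = n + ρ + 1 := by push_cast; ring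
      rw [h4]
      linarith
  have hlow : ∀ n : ℕ, Real.log (n + ρ + 1) - Real.log (1 + ρ) ≤
      ∑ k ∈ Finset.range n, 1 / ((k : ℝ) + ρ + 1) := by
    intro n
    induction n with
    | zero => simp [add_comm]
    | succ n ih =>
      have hx : 0 < (n : ℝ) + ρ := by positivity
      rw [Finset.sum_range_succ]
      have h := Real.log_le_sub_one_of_pos (x := ((n : ℝ) + ρ + 1 + 1) / (n + ρ + 1))
        (by positivity)
      rw [Real.log_div (by positivity) (by positivity)] at h
      have h3 : ((n : ℝ) + ρ + 1 + 1) / (n + ρ + 1) - 1 = 1 / (n + ρ + 1) := by field_simp; ring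
      have h4 : ((n + 1 : ℕ) : ℝ) + ρ + 1 = n + ρ + 1 + 1 := by push_cast; ring
      rw [h4]
      linarith
  have hn' : (1 : ℝ) ≤ n := by exact_mod_cast hn
  have h1 : Real.log n ≤ Real.log (n + ρ + 1) := Real.log_le_log (by linarith) (by linarith)
  have h2 : Real.log (n + ρ) ≤ Real.log n + Real.log (1 + ρ) := by
    rw [← Real.log_mul (by positivity) (by positivity)]
    exact Real.log_le_log (by positivity) (by nlinarith)
  have h3 := hup n
  have h4 := hlow n
  have h5 := le_abs_self (Real.log (1 + ρ))
  have h6 := neg_abs_le (Real.log ρ)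
  have h7 := abs_nonneg (Real.log ρ)
  rw [abs_le]
  constructor <;> linarith

/-- `∏_{k<n} (1 + z/(k+ρ+1)) ~ exp (z log n)` when `z → 0` as `n → ∞`. -/
theorem tendsto_prod_mul_exp_neg (hρ : 0 < ρ) {z : ℕ → ℂ} (hz : Tendsto z atTop (𝓝 0)) :
    Tendsto (fun n => (∏ k ∈ Finset.range n, (1 + z n / ((k : ℂ) + ρ + 1))) *
      Complex.exp (-(z n * Real.log n))) atTop (𝓝 1) := by
  have hcast (k : ℕ) : (k : ℂ) + ρ + 1 = ((k + ρ + 1 : ℝ) : ℂ) := by push_cast; rfl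
  have hsum : Summable fun k : ℕ => 1 / ((k : ℝ) + 1) ^ 2 := by
    have := (summable_nat_add_iff 1).2 (Real.summable_one_div_nat_pow (p := 2) |>.2 (by norm_num))
    simpa using this
  set A := ∑' k : ℕ, 1 / ((k : ℝ) + 1) ^ 2
  set B := |Real.log (1 + ρ)| + |Real.log ρ|
  have hexp : Tendsto (fun n => ∑ k ∈ Finset.range n, Complex.log (1 + z n / ((k : ℂ) + ρ + 1)) -
      z n * Real.log n) atTop (𝓝 0) := by
    have hz' : ∀ᶠ n in atTop, ‖z n‖ ≤ 1 / 2 := by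
      have := hz.norm
      rw [norm_zero] at this
      exact (this.eventually_lt_const (by norm_num : (0 : ℝ) < 1 / 2)).mono fun _ h => h.le
    have hlim : Tendsto (fun n => ‖z n‖ ^ 2 * A + ‖z n‖ * B) atTop (𝓝 0) := by
      have := hz.norm
      rw [norm_zero] at this
      simpa using ((this.pow 2).mul_const A).add (this.mul_const B)
    refine squeeze_zero_norm' ?_ hlim
    filter_upwards [hz', eventually_ge_atTop 1] with n hn hn1
    -- The remainders `log (1 + u) - u` are `O(‖z n‖² / (k + 1)²)` and sum to `O(‖z n‖²)`. The
    -- linear part differs from `z n * log n` by `O(‖z n‖)`, the harmonic sum being `log n + O(1)`.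
    have hsplit : ∑ k ∈ Finset.range n, Complex.log (1 + z n / ((k : ℂ) + ρ + 1)) -
        z n * Real.log n =
        ∑ k ∈ Finset.range n, (Complex.log (1 + z n / ((k : ℂ) + ρ + 1)) -
          z n / ((k : ℂ) + ρ + 1)) +
        z n * ((∑ k ∈ Finset.range n, 1 / ((k : ℝ) + ρ + 1) - Real.log n : ℝ) : ℂ) := by
      rw [Finset.sum_sub_distrib]
      push_cast
      rw [mul_sub, Finset.mul_sum]
      simp only [mul_one_div]
      ring
    rw [hsplit]
    refine (norm_add_le _ _).trans (add_le_add ?_ ?_)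
    · calc _ ≤ ∑ k ∈ Finset.range n, ‖z n‖ ^ 2 * (1 / ((k : ℝ) + 1) ^ 2) := by
            refine norm_sum_le_of_le _ fun k _ => ?_
            have hu : ‖z n / ((k : ℂ) + ρ + 1)‖ ≤ ‖z n‖ * (1 / ((k : ℝ) + 1)) := by
              rw [norm_div, hcast, Complex.norm_real, Real.norm_of_nonneg (by positivity),
                div_eq_mul_one_div]
              gcongr
              linarith
            have hk : 1 / ((k : ℝ) + 1) ≤ 1 := by
              rw [div_le_one (by positivity)]
              linarith [(Nat.cast_nonneg k : (0 : ℝ) ≤ k)]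
            have hu2 : ‖z n / ((k : ℂ) + ρ + 1)‖ ≤ 1 / 2 :=
              hu.trans ((mul_le_of_le_one_right (norm_nonneg _) hk).trans hn)
            refine (Complex.norm_log_one_add_sub_self_le (by linarith)).trans ?_
            have hi : (1 - ‖z n / ((k : ℂ) + ρ + 1)‖)⁻¹ ≤ 2 := by
              rw [inv_le_comm₀ (by linarith) (by norm_num)]
              linarith
            calc _ ≤ ‖z n / ((k : ℂ) + ρ + 1)‖ ^ 2 * 2 / 2 := by gcongr
              _ = ‖z n / ((k : ℂ) + ρ + 1)‖ ^ 2 := by ring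
              _ ≤ (‖z n‖ * (1 / ((k : ℝ) + 1))) ^ 2 := by gcongr
              _ = _ := by rw [mul_pow, one_div_pow]
        _ ≤ _ := by
            rw [← Finset.mul_sum]
            gcongr
            exact hsum.sum_le_tsum _ fun k _ => by positivity
    · rw [norm_mul, Complex.norm_real, Real.norm_eq_abs]
      gcongr
      exact abs_sum_inv_sub_log_le hρ hn1
  have := (Complex.continuous_exp.tendsto 0).comp hexp
  rw [Complex.exp_zero] at this
  refine this.congr' ?_
  have hz' : ∀ᶠ n in atTop, ‖z n‖ < 1 := by
    have := hz.norm
    rw [norm_zero] at this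
    exact this.eventually_lt_const one_pos
  filter_upwards [hz'] with n hn
  rw [Function.comp_apply, Complex.exp_sub, Complex.exp_sum, Complex.exp_neg, div_eq_mul_inv]
  congr 1
  refine Finset.prod_congr rfl fun k _ => Complex.exp_log fun h => ?_
  have h1 : ‖z n / ((k : ℂ) + ρ + 1)‖ < 1 := by
    rw [norm_div, hcast, Complex.norm_real, Real.norm_of_nonneg (by positivity),
      div_lt_one (by positivity)]
    have : (0 : ℝ) ≤ k := Nat.cast_nonneg k
    linarith
  rw [eq_neg_of_add_eq_zero_right h] at h1
  simp at h1

/-- The normalizer at `q` relative to its value at `q = 1`. -/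
theorem normalizer_inv_mul (hρ : 0 < ρ) (q : ℂ) (n : ℕ) :
    (normalizer ρ q n)⁻¹ * (ρ / ((n : ℂ) + ρ)) =
      ∏ k ∈ Finset.range n, (1 + (q - 1) / ((k : ℂ) + ρ + 1)) := by
  rw [normalizer, inv_inv]
  have hρ' : (ρ : ℂ) ≠ 0 := by exact_mod_cast hρ.ne'
  induction n with
  | zero => simp [hρ']
  | succ n ih =>
    rw [Finset.prod_range_succ, Finset.prod_range_succ, ← ih]
    have h1 := natCast_add_ne_zero hρ n
    have h2 := natCast_add_ne_zero hρ (n + 1)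
    have h3 : (n : ℂ) + ρ + 1 = ((n + 1 : ℕ) : ℂ) + ρ := by push_cast; ring
    rw [h3]
    field_simp
    push_cast
    ring

end Asymptotics

/-! ### Characteristic functions: expansion at the origin and convergence -/

section CharFun

/-- Second order expansion of a characteristic function at the origin. -/
theorem tendsto_charFun_sub_div_sq {ν : Measure ℝ} [IsProbabilityMeasure ν]
    (hν : MemLp id 2 ν) :
    Tendsto (fun t : ℝ => (charFun ν t - 1 - (∫ x, x ∂ν : ℝ) * t * Complex.I) / (t : ℂ) ^ 2)
      (𝓝[≠] 0) (𝓝 (-((∫ x, x ^ 2 ∂ν : ℝ) : ℂ) / 2)) := by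
  have h := taylor_isLittleO_univ (x₀ := 0) (contDiff_charFun (n := 2) hν)
  have h1 (t : ℝ) : taylorWithinEval (charFun ν) 2 Set.univ 0 t =
      1 + (∫ x, x ∂ν : ℝ) * t * Complex.I - (∫ x, x ^ 2 ∂ν : ℝ) * t ^ 2 / 2 := by
    have := taylorWithinEval_charFun_two_zero (P := ν) (X := id) aemeasurable_id
      (by simpa using hν) t
    simpa using this
  simp only [sub_zero] at h
  have h2 := (h.mono (nhdsWithin_le_nhds (s := {0}ᶜ)))
  rw [← Asymptotics.isLittleO_norm_right] at h2
  have h3 : (fun t : ℝ => charFun ν t - taylorWithinEval (charFun ν) 2 Set.univ 0 t)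
      =o[𝓝[≠] 0] fun t : ℝ => (t : ℂ) ^ 2 := by
    rw [← Asymptotics.isLittleO_norm_right]
    refine h2.congr_right fun t => ?_
    simp
  have h4 := h3.tendsto_div_nhds_zero.add_const (-((∫ x, x ^ 2 ∂ν : ℝ) : ℂ) / 2)
  rw [zero_add] at h4
  refine h4.congr' ?_
  filter_upwards [self_mem_nhdsWithin] with t ht
  have ht' : (t : ℂ) ≠ 0 := by simpa using ht
  rw [h1]
  field_simp
  ring

theorem tendsto_inv_sqrt_log :
    Tendsto (fun n : ℕ => (√(Real.log n))⁻¹) atTop (𝓝[>] 0) := by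
  have h : Tendsto (fun n : ℕ => √(Real.log n)) atTop atTop :=
    Real.tendsto_sqrt_atTop.comp (Real.tendsto_log_atTop.comp tendsto_natCast_atTop_atTop)
  exact tendsto_inv_atTop_nhdsGT_zero.comp h

/-- The Gaussian limit of the mean of the empirical characteristic function. -/
theorem tendsto_normalizer_inv_sqrt_log {ρ : ℝ} (hρ : 0 < ρ) {ν : Measure ℝ}
    [IsProbabilityMeasure ν] (hν : MemLp id 2 ν) :
    Tendsto (fun n : ℕ => Complex.exp (-((∫ x, x ∂ν : ℝ) * √(Real.log n) * Complex.I)) *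
        ((normalizer ρ (charFun ν (√(Real.log n))⁻¹) n)⁻¹ * (ρ / ((n : ℂ) + ρ))))
      atTop (𝓝 (Complex.exp (-((∫ x, x ^ 2 ∂ν : ℝ) : ℂ) / 2))) := by
  have ht := tendsto_inv_sqrt_log
  have hz : Tendsto (fun n : ℕ => charFun ν (√(Real.log n))⁻¹ - 1) atTop (𝓝 0) := by
    have h := (((continuous_charFun (μ := ν)).tendsto 0).comp
      (tendsto_nhds_of_tendsto_nhdsWithin ht)).sub_const 1
    simpa [charFun_zero] using h
  have h1 := tendsto_prod_mul_exp_neg hρ hz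
  have h2 := (Complex.continuous_exp.tendsto _).comp ((tendsto_charFun_sub_div_sq hν).comp
    (ht.mono_right (nhdsWithin_mono _ fun x (hx : 0 < x) => hx.ne')))
  have h3 := h1.mul h2
  rw [one_mul] at h3
  refine h3.congr' ?_
  filter_upwards [ht.eventually self_mem_nhdsWithin] with n hn
  have hs : √(Real.log n) ≠ 0 := by
    have : 0 < (√(Real.log n))⁻¹ := hn
    exact (inv_pos.1 this).ne'
  have hl : (Real.log n : ℂ) = (√(Real.log n) : ℂ) ^ 2 := by
    rw [← Complex.ofReal_pow, Real.sq_sqrt]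
    by_contra h
    exact hs (Real.sqrt_eq_zero_of_nonpos (not_le.1 h).le)
  have hs' : (√(Real.log n) : ℂ) ≠ 0 := by exact_mod_cast hs
  rw [normalizer_inv_mul hρ, Function.comp_apply, Function.comp_apply, mul_assoc, ← Complex.exp_add,
    mul_comm]
  -- With `t = (log n)^(-1/2)`, the exponent `(φ(t) - 1) log n - i m √(log n)` equals `(φ(t) - 1 - i
  -- m t) / t²`.
  congr 2
  rw [hl]
  push_cast
  field_simp
  ring

variable {E : Type*} [NormedAddCommGroup E] [InnerProductSpace ℝ E] [MeasurableSpace E]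
  [BorelSpace E] [SecondCountableTopology E]

/-- Krein's inequality. -/
theorem norm_charFun_sub_sq_le (μ : Measure E) [IsProbabilityMeasure μ] (s t : E) :
    ‖charFun μ s - charFun μ t‖ ^ 2 ≤ 2 * (1 - (charFun μ (s - t)).re) := by
  have hi (r : E) : Integrable (fun x => Complex.exp (inner ℝ x r * Complex.I)) μ :=
    Integrable.of_bound (by fun_prop) 1 (.of_forall fun x => by
      simp [Complex.norm_exp_ofReal_mul_I])
  have h1 : charFun μ s - charFun μ t =
      ∫ x, (Complex.exp (inner ℝ x s * Complex.I) - Complex.exp (inner ℝ x t * Complex.I)) ∂μ := by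
    rw [charFun_apply, charFun_apply, integral_sub (hi s) (hi t)]
  have h2 (x : E) : ‖Complex.exp (inner ℝ x s * Complex.I) -
      Complex.exp (inner ℝ x t * Complex.I)‖ ^ 2 =
      2 * (1 - (Complex.exp (inner ℝ x (s - t) * Complex.I)).re) := by
    rw [← Complex.normSq_eq_norm_sq, Complex.normSq_apply, inner_sub_right]
    simp only [Complex.sub_re, Complex.sub_im, Complex.exp_ofReal_mul_I_re,
      Complex.exp_ofReal_mul_I_im, Real.cos_sub]
    nlinarith [Real.sin_sq_add_cos_sq (inner ℝ x s), Real.sin_sq_add_cos_sq (inner ℝ x t)]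
  have hg : Integrable (fun x => 2 * (1 - (Complex.exp (inner ℝ x (s - t) * Complex.I)).re)) μ :=
    ((integrable_const _).sub (hi (s - t)).re).const_mul 2
  have h3 : ∫ x, 2 * (1 - (Complex.exp (inner ℝ x (s - t) * Complex.I)).re) ∂μ =
      2 * (1 - (charFun μ (s - t)).re) := by
    have hre : Integrable (fun x => (Complex.exp (inner ℝ x (s - t) * Complex.I)).re) μ :=
      (hi (s - t)).re
    rw [integral_const_mul, integral_sub (integrable_const _) hre, charFun_apply]
    have := integral_re (hi (s - t))
    simp only [RCLike.re_eq_complex_re] at this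
    rw [this]
    simp
  set f : E → ℝ := fun x => ‖Complex.exp (inner ℝ x s * Complex.I) -
    Complex.exp (inner ℝ x t * Complex.I)‖ with hf
  have hfi : Integrable f μ := ((hi s).sub (hi t)).norm
  have hf2 : Integrable (fun x => f x ^ 2) μ := hg.congr (.of_forall fun x => (h2 x).symm)
  -- Nonnegativity of the variance of `f`.
  have h4 : (∫ x, f x ∂μ) ^ 2 ≤ ∫ x, f x ^ 2 ∂μ := by
    have h5 : 0 ≤ ∫ x, (f x - ∫ x, f x ∂μ) ^ 2 ∂μ := integral_nonneg fun x => sq_nonneg _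
    have h6 : ∫ x, (f x - ∫ x, f x ∂μ) ^ 2 ∂μ = ∫ x, f x ^ 2 ∂μ - (∫ x, f x ∂μ) ^ 2 := by
      generalize hc : ∫ x, f x ∂μ = c
      have h7 : Integrable (fun x => 2 * f x * c) μ := (hfi.const_mul 2).mul_const c
      have h8 : Integrable (fun x => f x ^ 2 - 2 * f x * c) μ := hf2.sub h7
      simp only [sub_sq]
      rw [integral_add h8 (integrable_const _), integral_sub hf2 h7, integral_mul_const,
        integral_const_mul, hc]
      simp
      ring
    linarith
  calc _ ≤ (∫ x, f x ∂μ) ^ 2 := by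
        rw [h1]
        gcongr
        exact norm_integral_le_integral_norm _
    _ ≤ _ := h4
    _ = _ := by rw [← h3]; exact integral_congr_ae (.of_forall h2)

/-- For characteristic functions of probability measures, convergence almost everywhere implies
convergence everywhere. -/
theorem tendsto_charFun_of_ae [FiniteDimensional ℝ E] {μ : ℕ → ProbabilityMeasure E}
    {μ₀ : ProbabilityMeasure E}
    (h : ∀ᵐ t : E, Tendsto (fun n => charFun (μ n : Measure E) t) atTop
      (𝓝 (charFun (μ₀ : Measure E) t))) (t : E) :
    Tendsto (fun n => charFun (μ n : Measure E) t) atTop (𝓝 (charFun (μ₀ : Measure E) t)) := by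
  have h' : ∀ᵐ s : E, Tendsto (fun n => charFun (μ n : Measure E) (t - s)) atTop
      (𝓝 (charFun (μ₀ : Measure E) (t - s))) :=
    (Measure.measurePreserving_sub_left volume t).quasiMeasurePreserving.ae h
  rw [Metric.tendsto_atTop]
  intro ε hε
  have hc : ∀ᶠ s in 𝓝 t, ‖charFun (μ₀ : Measure E) s - charFun (μ₀ : Measure E) t‖ < ε / 3 ∧
      2 * (1 - (charFun (μ₀ : Measure E) (t - s)).re) < (ε / 3) ^ 2 := by
    have hcont := continuous_charFun (μ := (μ₀ : Measure E))
    refine .and ?_ ?_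
    · have : Continuous fun s => ‖charFun (μ₀ : Measure E) s - charFun (μ₀ : Measure E) t‖ := by
        fun_prop
      refine this.continuousAt.eventually_lt_const ?_
      simpa using by positivity
    · have : Continuous fun s => 2 * (1 - (charFun (μ₀ : Measure E) (t - s)).re) := by
        fun_prop
      refine this.continuousAt.eventually_lt_const ?_
      simpa [charFun_zero] using by positivity
  -- A set of full measure is dense, so some `s` near `t` has convergence both at `s` and at `t -
  -- s`. Krein's inequality then bounds the change of the `n`-th characteristic function between `s`
  -- and `t` through its value at `t - s`, which is close to `1` for large `n`. This replaces an
  -- equicontinuity assumption.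
  obtain ⟨s, ⟨hs1, hs2⟩, hs3, hs4⟩ :=
    ((Measure.dense_of_ae (h.and h')).inter_nhds_nonempty hc)
  have e1 := (Metric.tendsto_atTop.1 hs1) (ε / 3) (by positivity)
  have e2 : ∀ᶠ n in atTop, 2 * (1 - (charFun (μ n : Measure E) (t - s)).re) < (ε / 3) ^ 2 := by
    have : Tendsto (fun n => 2 * (1 - (charFun (μ n : Measure E) (t - s)).re)) atTop
        (𝓝 (2 * (1 - (charFun (μ₀ : Measure E) (t - s)).re))) :=
      ((((Complex.continuous_re.tendsto _).comp hs2).const_sub 1).const_mul 2)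
    exact this.eventually_lt_const hs4
  obtain ⟨N₁, hN₁⟩ := e1
  obtain ⟨N₂, hN₂⟩ := eventually_atTop.1 e2
  refine ⟨max N₁ N₂, fun n hn => ?_⟩
  have k1 := hN₁ n ((le_max_left _ _).trans hn)
  have k2 := hN₂ n ((le_max_right _ _).trans hn)
  have k3 : ‖charFun (μ n : Measure E) t - charFun (μ n : Measure E) s‖ < ε / 3 :=
    lt_of_pow_lt_pow_left₀ 2 (by positivity) ((norm_charFun_sub_sq_le _ t s).trans_lt k2)
  rw [dist_eq_norm] at k1 ⊢
  have : charFun (μ n : Measure E) t - charFun (μ₀ : Measure E) t =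
      (charFun (μ n : Measure E) t - charFun (μ n : Measure E) s) +
      (charFun (μ n : Measure E) s - charFun (μ₀ : Measure E) s) +
      (charFun (μ₀ : Measure E) s - charFun (μ₀ : Measure E) t) := by ring
  rw [this]
  refine (norm_add₃_le ..).trans_lt ?_
  linarith

end CharFun

/-! ### Positions of the branching walk -/

section Position

theorem position_zero {E : Type*} [AddMonoid E] (p : GrowingTree) (y : ℕ → E) :
    position p y 0 = 0 := by
  rw [position]

theorem position_succ {E : Type*} [AddMonoid E] (p : GrowingTree) (y : ℕ → E) (n : ℕ) :
    position p y (n + 1) = position p y (p n) + y (n + 1) := by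
  rw [position]

theorem map_position {E F : Type*} [AddMonoid E] [AddMonoid F] (L : E →+ F) (p : GrowingTree)
    (y : ℕ → E) (v : ℕ) : L (position p y v) = position p (fun v => L (y v)) v := by
  induction v using Nat.strong_induction_on with
  | _ v ih =>
    cases v with
    | zero => simp [position_zero]
    | succ n => rw [position_succ, position_succ, map_add, ih _ (p n).isLt]

theorem measurable_position {Ω E : Type*} [MeasurableSpace Ω] [AddMonoid E] [MeasurableSpace E]
    [MeasurableAdd₂ E] {T : Ω → GrowingTree} {y : ℕ → Ω → E} {n : ℕ}
    (hT : ∀ i < n, Measurable fun ω => T ω i) (hy : ∀ i ≤ n, Measurable (y i)) {v : ℕ}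
    (hv : v ≤ n) : Measurable fun ω => position (T ω) (fun v => y v ω) v := by
  induction v using Nat.strong_induction_on with
  | _ v ih =>
    cases v with
    | zero => simp only [position_zero]; exact measurable_const
    | succ k =>
      simp only [position_succ]
      refine Measurable.add ?_ (hy _ hv)
      -- The parent is a random index with finitely many values, so joint measurability in the index
      -- and `ω` is automatic.
      have h1 : Measurable fun p : Fin (k + 1) × Ω =>
          position (T p.2) (fun v => y v p.2) (p.1 : ℕ) :=
        measurable_from_prod_countable_right fun j => ih j j.isLt (by omega)
      exact h1.comp ((hT k (by omega)).prodMk measurable_id)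

end Position

/-! ### Weighted exponential sums and their derivatives -/

section ExpSum

/-- The weighted exponential sum `∑ w_v exp (i s x_v)`. -/
def expSum (ρ : ℝ) (x : ℕ → ℝ) (n : ℕ) (s : ℝ) : ℂ :=
  ∑ v ∈ Finset.range (n + 1), (nodeWeight ρ v : ℂ) * Complex.exp (s * x v * Complex.I)

/-- The derivative of `expSum` with respect to `s`. -/
def expSumDeriv (ρ : ℝ) (x : ℕ → ℝ) (n : ℕ) (s : ℝ) : ℂ :=
  ∑ v ∈ Finset.range (n + 1),
    (nodeWeight ρ v : ℂ) * (x v * Complex.I * Complex.exp (s * x v * Complex.I))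

variable {ρ : ℝ}

theorem hasDerivAt_exp_mul_I (a s : ℝ) :
    HasDerivAt (fun s : ℝ => Complex.exp (s * a * Complex.I))
      (a * Complex.I * Complex.exp (s * a * Complex.I)) s := by
  have h1 : HasDerivAt (fun s : ℝ => (s : ℂ) * a * Complex.I) (a * Complex.I) s := by
    have := ((Complex.ofRealCLM.hasDerivAt (x := s)).mul_const (a : ℂ)).mul_const Complex.I
    simpa using this
  simpa [mul_comm] using h1.cexp

theorem hasDerivAt_expSum (x : ℕ → ℝ) (n : ℕ) (s : ℝ) :
    HasDerivAt (expSum ρ x n) (expSumDeriv ρ x n s) s := by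
  unfold expSum expSumDeriv
  exact HasDerivAt.fun_sum fun v _ => (hasDerivAt_exp_mul_I (x v) s).const_mul _

theorem norm_exp_mul_I (s a : ℝ) : ‖Complex.exp (s * a * Complex.I)‖ = 1 := by
  rw [← Complex.ofReal_mul, Complex.norm_exp_ofReal_mul_I]

theorem norm_expSum_le (hρ : 0 < ρ) (x : ℕ → ℝ) (n : ℕ) (s : ℝ) :
    ‖expSum ρ x n s‖ ≤ totalWeight ρ n := by
  refine norm_sum_le_of_le _ fun v _ => ?_
  rw [norm_mul, norm_exp_mul_I, mul_one, Complex.norm_real,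
    Real.norm_of_nonneg (nodeWeight_nonneg hρ v)]

theorem norm_expSumDeriv_le (hρ : 0 < ρ) (x : ℕ → ℝ) (n : ℕ) (s : ℝ) :
    ‖expSumDeriv ρ x n s‖ ≤ ∑ v ∈ Finset.range (n + 1), nodeWeight ρ v * |x v| := by
  refine norm_sum_le_of_le _ fun v _ => ?_
  rw [norm_mul, norm_mul, norm_mul, norm_exp_mul_I, mul_one, Complex.norm_real, Complex.norm_real,
    Real.norm_of_nonneg (nodeWeight_nonneg hρ v), Complex.norm_I, mul_one, Real.norm_eq_abs]

theorem expSum_zero_right (x : ℕ → ℝ) (n : ℕ) : expSum ρ x n 0 = totalWeight ρ n := by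
  simp [expSum, totalWeight]

theorem totalWeight_succ (n : ℕ) : totalWeight ρ (n + 1) = totalWeight ρ n + 1 := by
  rw [totalWeight_eq, totalWeight_eq]; push_cast; ring

theorem expSum_succ (x : ℕ → ℝ) (n : ℕ) (s : ℝ) :
    expSum ρ x (n + 1) s = expSum ρ x n s + Complex.exp (s * x (n + 1) * Complex.I) := by
  rw [expSum, Finset.sum_range_succ]
  simp [nodeWeight, expSum]

theorem expSumDeriv_succ (x : ℕ → ℝ) (n : ℕ) (s : ℝ) :
    expSumDeriv ρ x (n + 1) s = expSumDeriv ρ x n s +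
      x (n + 1) * Complex.I * Complex.exp (s * x (n + 1) * Complex.I) := by
  rw [expSumDeriv, Finset.sum_range_succ]
  simp [nodeWeight, expSumDeriv]

theorem measurable_expSum {Ω : Type*} [MeasurableSpace Ω] {x : ℕ → Ω → ℝ} {n : ℕ}
    (hx : ∀ v ≤ n, Measurable (x v)) :
    Measurable fun p : Ω × ℝ => expSum ρ (fun v => x v p.1) n p.2 := by
  unfold expSum
  refine Finset.measurable_fun_sum _ fun v hv => ?_
  have := hx v (Nat.lt_succ_iff.1 (Finset.mem_range.1 hv))
  fun_prop

theorem measurable_expSumDeriv {Ω : Type*} [MeasurableSpace Ω] {x : ℕ → Ω → ℝ} {n : ℕ}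
    (hx : ∀ v ≤ n, Measurable (x v)) :
    Measurable fun p : Ω × ℝ => expSumDeriv ρ (fun v => x v p.1) n p.2 := by
  unfold expSumDeriv
  refine Finset.measurable_fun_sum _ fun v hv => ?_
  have := hx v (Nat.lt_succ_iff.1 (Finset.mem_range.1 hv))
  fun_prop

end ExpSum

/-! ### Derivative of the characteristic function -/

section CharFunDeriv

/-- The derivative of the characteristic function. -/
def charFunDeriv (ν : Measure ℝ) (s : ℝ) : ℂ :=
  ∫ x, (x : ℂ) * Complex.I * Complex.exp (s * x * Complex.I) ∂ν

variable {ν : Measure ℝ}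

theorem hasDerivAt_charFun [IsProbabilityMeasure ν] (hν : MemLp id 2 ν) (s : ℝ) :
    HasDerivAt (charFun ν) (charFunDeriv ν s) s := by
  have h1 : MemLp id (1 : ℕ) ν := hν.mono_exponent (by norm_num)
  have h2 := (contDiff_charFun h1).differentiable (by norm_num) s
  have h3 := iteratedDeriv_charFun (t := s) h1
  rw [iteratedDeriv_one] at h3
  refine h2.hasDerivAt.congr_deriv ?_
  rw [h3, charFunDeriv, pow_one, ← integral_const_mul]
  congr 1
  ext x
  ring

theorem continuous_charFunDeriv [IsProbabilityMeasure ν] (hν : MemLp id 2 ν) :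
    Continuous (charFunDeriv ν) := by
  have h1 : MemLp id (1 : ℕ) ν := hν.mono_exponent (by norm_num)
  have h2 := (contDiff_charFun h1).continuous_deriv (by norm_num)
  rwa [show deriv (charFun ν) = charFunDeriv ν from
    funext fun s => (hasDerivAt_charFun hν s).deriv] at h2

theorem norm_charFunDeriv_le (s : ℝ) : ‖charFunDeriv ν s‖ ≤ ∫ x, |x| ∂ν := by
  refine (norm_integral_le_integral_norm _).trans (le_of_eq ?_)
  congr 1
  ext x
  rw [norm_mul, norm_mul, norm_exp_mul_I]
  simp

end CharFunDeriv

/-! ### Second moments of the walk -/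

section Moments

variable {Ω : Type*} {T : Ω → GrowingTree} {y : ℕ → Ω → ℝ} {ρ : ℝ}

/-- The positions of the branching walk as random variables. -/
def walk (T : Ω → GrowingTree) (y : ℕ → Ω → ℝ) (v : ℕ) (ω : Ω) : ℝ :=
  position (T ω) (fun v => y v ω) v

theorem walk_succ (n : ℕ) (ω : Ω) :
    walk T y (n + 1) ω = walk T y (T ω n) ω + y (n + 1) ω := position_succ _ _ _

variable [MeasurableSpace Ω] {P : Measure Ω} {ν : Measure ℝ}

theorem measurable_walk_treeFiltration (hT : Measurable T) (hy : ∀ v, Measurable (y v)) {v n : ℕ}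
    (hv : v ≤ n) : Measurable[treeFiltration hT hy n] (walk T y v) :=
  @measurable_position Ω ℝ (treeFiltration hT hy n) _ _ _ T y n
    (fun _ hi => measurable_parent_treeFiltration hT hy hi)
    (fun _ hi => measurable_offset_treeFiltration hT hy hi) v hv

theorem measurable_walk (hT : Measurable T) (hy : ∀ v, Measurable (y v)) (v : ℕ) :
    Measurable (walk T y v) :=
  (measurable_walk_treeFiltration hT hy le_rfl).mono ((treeFiltration hT hy).le v) le_rfl

theorem IsOffsetFamily.memLp (hy : IsOffsetFamily P ν T y) (hν : MemLp id 2 ν) (v : ℕ) :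
    MemLp (y v) 2 P := by
  rw [← hy.law v] at hν
  exact hν.comp_of_map (hy.measurable v).aemeasurable

theorem memLp_walk [IsProbabilityMeasure P] [IsProbabilityMeasure ν] (hT : Measurable T)
    (hy : IsOffsetFamily P ν T y) (hν : MemLp id 2 ν) (v : ℕ) :
    MemLp (walk T y v) 2 P := by
  induction v using Nat.strong_induction_on with
  | _ v ih =>
    cases v with
    | zero =>
      have : walk T y 0 = 0 := by ext ω; exact position_zero _ _
      rw [this]
      exact MemLp.zero
    | succ n =>
      -- The position of the random parent is dominated by the sum over all possible parents.
      have h1 : MemLp (fun ω => ∑ k ∈ Finset.range (n + 1), |walk T y k ω| + |y (n + 1) ω|) 2 P :=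
        (memLp_finsetSum _ fun k hk => (ih k (Finset.mem_range.1 hk)).abs).add
          (hy.memLp hν (n + 1)).abs
      refine h1.mono (measurable_walk hT hy.measurable _).aestronglyMeasurable
        (.of_forall fun ω => ?_)
      rw [walk_succ, Real.norm_eq_abs]
      refine (abs_add_le _ _).trans (le_trans ?_ (le_abs_self _))
      gcongr
      exact Finset.single_le_sum (f := fun k => |walk T y k ω|) (fun _ _ => abs_nonneg _)
        (Finset.mem_range.2 (T ω n).isLt)

/-- The expected second moment of the weighted empirical distribution. -/
def meanSquare (P : Measure Ω) (ρ : ℝ) (x : ℕ → Ω → ℝ) (n : ℕ) : ℝ :=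
  (∑ v ∈ Finset.range (n + 1), nodeWeight ρ v * ∫ ω, x v ω ^ 2 ∂P) / totalWeight ρ n

variable [IsProbabilityMeasure P] [IsProbabilityMeasure ν]

/-- This is `(a + b)² ≤ (1 + 1/4) a² + (1 + 4) b²`, with `a` the position of the parent, whose
second moment is `meanSquare`. The excess `1/4` over `1` becomes the growth exponent of
`meanSquare`, hence the uneven weights. -/
theorem integral_walk_succ_sq_le (hT : IsWeightedRRT P ρ T)
    (hy : IsOffsetFamily P ν T y) (hν : MemLp id 2 ν) (n : ℕ) :
    ∫ ω, walk T y (n + 1) ω ^ 2 ∂P ≤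
      5 / 4 * meanSquare P ρ (walk T y) n + 5 * ∫ x, x ^ 2 ∂ν := by
  have hx (v) := memLp_walk hT.measurable hy hν v
  obtain ⟨h1, h2⟩ := integral_newNode hT hy n (f := fun k ω => walk T y k ω ^ 2)
    (fun k hk => (measurable_walk_treeFiltration hT.measurable hy.measurable hk).pow_const 2)
    (fun k _ => (hx k).integrable_sq) (h := fun _ => 1) measurable_const (integrable_const _)
  simp only [mul_one, integral_const, probReal_univ, smul_eq_mul,
    RCLike.ofReal_real_eq_id, id] at h1 h2
  have h3 : ∫ ω, y (n + 1) ω ^ 2 ∂P = ∫ x, x ^ 2 ∂ν := by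
    rw [← hy.law (n + 1), integral_map (hy.measurable _).aemeasurable (by fun_prop)]
  have h4 := (hy.memLp hν (n + 1)).integrable_sq
  calc ∫ ω, walk T y (n + 1) ω ^ 2 ∂P
      ≤ ∫ ω, (5 / 4 * walk T y (T ω n) ω ^ 2 + 5 * y (n + 1) ω ^ 2) ∂P := by
        refine integral_mono (hx _).integrable_sq ((h1.const_mul _).add (h4.const_mul _))
          fun ω => ?_
        simp only [walk_succ]
        nlinarith [sq_nonneg (walk T y (T ω n) ω / 2 - 2 * y (n + 1) ω)]
    _ = _ := by
        rw [integral_add (h1.const_mul _) (h4.const_mul _), integral_const_mul,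
          integral_const_mul, h2, h3, meanSquare]

/-- Adding a node of weight `1` averages the old value with a new one exceeding it by at most a
quarter plus a constant, so the Gronwall bound applies with `ε = 1/4`. Against the factor `n^(-3/2)`
from the squared normalizer, any exponent below `1/2` would suffice. -/
theorem meanSquare_le (hρ : 0 < ρ) (hT : IsWeightedRRT P ρ T)
    (hy : IsOffsetFamily P ν T y) (hν : MemLp id 2 ν) (n : ℕ) :
    meanSquare P ρ (walk T y) n ≤
      20 * (∫ x, x ^ 2 ∂ν) * (((n : ℝ) + ρ) / ρ) ^ (1 / 4 : ℝ) := by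
  have hσ : 0 ≤ ∫ x, x ^ 2 ∂ν := integral_nonneg fun _ => sq_nonneg _
  have h0 : meanSquare P ρ (walk T y) 0 = 0 := by
    have : walk T y 0 = 0 := by ext ω; exact position_zero _ _
    simp [meanSquare, this]
  have h := le_rpow_of_le_mul_add (b := meanSquare P ρ (walk T y)) hρ
    (ε := 1 / 4) (c := 5 * ∫ x, x ^ 2 ∂ν) (by norm_num) (by positivity) h0.ge (fun n => ?_) n
  · refine h.trans (le_of_eq ?_)
    rw [h0]
    ring
  · have h1 := integral_walk_succ_sq_le hT hy hν n
    have hW := totalWeight_pos hρ n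
    have h2 : meanSquare P ρ (walk T y) (n + 1) * (totalWeight ρ n + 1) =
        meanSquare P ρ (walk T y) n * totalWeight ρ n + ∫ ω, walk T y (n + 1) ω ^ 2 ∂P := by
      rw [meanSquare, meanSquare, totalWeight_succ, div_mul_cancel₀ _ (by positivity),
        div_mul_cancel₀ _ (by positivity), Finset.sum_range_succ]
      simp [nodeWeight]
    rw [← totalWeight_eq]
    have h3 : meanSquare P ρ (walk T y) n * (1 + 1 / 4 / (totalWeight ρ n + 1)) +
        5 * (∫ x, x ^ 2 ∂ν) / (totalWeight ρ n + 1) =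
        (meanSquare P ρ (walk T y) n * (totalWeight ρ n + 5 / 4) + 5 * ∫ x, x ^ 2 ∂ν) /
          (totalWeight ρ n + 1) := by
      field_simp
      ring
    rw [h3, le_div_iff₀ (by positivity), h2]
    linarith

end Moments

/-! ### Orthogonality of the innovations to the past -/

section Orthogonality

variable {Ω : Type*} [MeasurableSpace Ω] {P : Measure Ω} {ρ : ℝ}
  {T : Ω → GrowingTree} {ν : Measure ℝ} {y : ℕ → Ω → ℝ}

/-- The increment of `expSum`, centered given the past; `q` is the value of the characteristic
function of the offsets. -/
def innovation (ρ : ℝ) (q : ℂ) (x : ℕ → ℝ) (n : ℕ) (s : ℝ) : ℂ :=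
  Complex.exp (s * x (n + 1) * Complex.I) - q / ((n : ℂ) + ρ) * expSum ρ x n s

/-- The increment of `expSumDeriv`, centered given the past. -/
def innovationDeriv (ρ : ℝ) (q q' : ℂ) (x : ℕ → ℝ) (n : ℕ) (s : ℝ) : ℂ :=
  x (n + 1) * Complex.I * Complex.exp (s * x (n + 1) * Complex.I) -
    (q / ((n : ℂ) + ρ) * expSumDeriv ρ x n s + q' / ((n : ℂ) + ρ) * expSum ρ x n s)

theorem ofReal_totalWeight (n : ℕ) : (totalWeight ρ n : ℂ) = (n : ℂ) + ρ := by
  rw [totalWeight_eq]; push_cast; rfl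

theorem integrable_mul_exp {g : Ω → ℂ} (hg : Integrable g P) {x : Ω → ℝ} (hx : Measurable x)
    (s : ℝ) : Integrable (fun ω => g ω * Complex.exp (s * x ω * Complex.I)) P :=
  hg.mul_bdd (c := 1) (by fun_prop) (.of_forall fun ω => (norm_exp_mul_I _ _).le)

theorem integrable_mul_mul_exp {g : Ω → ℂ} (hg : MemLp g 2 P) {x : Ω → ℝ} (hx : Measurable x)
    (hx2 : MemLp x 2 P) (s : ℝ) :
    Integrable (fun ω => g ω * (x ω * Complex.I * Complex.exp (s * x ω * Complex.I))) P := by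
  have h1 : Integrable (fun ω => g ω * (x ω : ℂ)) P := hg.integrable_mul hx2.ofReal
  have := integrable_mul_exp (h1.mul_const Complex.I) hx s
  refine this.congr (.of_forall fun ω => ?_)
  simp only
  ring

variable [IsProbabilityMeasure P] [IsProbabilityMeasure ν]

/-- The exponential at the new node factorizes into the exponential at its parent and that of its
offset. Averaging the former over the parent gives the normalized exponential sum; the latter
contributes `φ(s)`. -/
theorem integral_mul_innovation (hT : IsWeightedRRT P ρ T)
    (hy : IsOffsetFamily P ν T y) (n : ℕ) (s : ℝ) {g : Ω → ℂ}
    (hg : Measurable[treeFiltration hT.measurable hy.measurable n] g) (hgi : Integrable g P) :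
    Integrable (fun ω => g ω * innovation ρ (charFun ν s) (fun v => walk T y v ω) n s) P ∧
    ∫ ω, g ω * innovation ρ (charFun ν s) (fun v => walk T y v ω) n s ∂P = 0 := by
  have hm (v) := measurable_walk hT.measurable hy.measurable v
  have hgm := hg.mono ((treeFiltration hT.measurable hy.measurable).le n) le_rfl
  have hi (v) := integrable_mul_exp hgi (hm v) s
  obtain ⟨h1, h2⟩ := integral_newNode hT hy n
    (f := fun k ω => g ω * Complex.exp (s * walk T y k ω * Complex.I))
    (fun k hk => by
      have := measurable_walk_treeFiltration hT.measurable hy.measurable hk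
      exact hg.mul (Complex.measurable_exp.comp
        (((Complex.measurable_ofReal.comp this).const_mul _).mul_const _)))
    (fun k _ => hi k) (h := fun x => Complex.exp (s * x * Complex.I)) (by fun_prop)
    (Integrable.of_bound (by fun_prop) 1 (.of_forall fun x => (norm_exp_mul_I _ _).le))
  have e1 : (fun ω => g ω * Complex.exp (s * walk T y (T ω n) ω * Complex.I) *
      Complex.exp (s * y (n + 1) ω * Complex.I)) =
      fun ω => g ω * Complex.exp (s * walk T y (n + 1) ω * Complex.I) := by
    ext ω
    rw [mul_assoc, ← Complex.exp_add, walk_succ]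
    congr 2
    push_cast
    ring
  have e2 : (fun ω => g ω * expSum ρ (fun v => walk T y v ω) n s) = fun ω =>
      ∑ k ∈ Finset.range (n + 1), (nodeWeight ρ k : ℂ) *
        (g ω * Complex.exp (s * walk T y k ω * Complex.I)) := by
    ext ω
    rw [expSum, Finset.mul_sum]
    exact Finset.sum_congr rfl fun k _ => by ring
  have i2 : Integrable (fun ω => g ω * expSum ρ (fun v => walk T y v ω) n s) P := by
    rw [e2]
    exact integrable_finsetSum _ fun k _ => (hi k).const_mul _
  have h3 : ∫ ω, g ω * expSum ρ (fun v => walk T y v ω) n s ∂P =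
      ∑ k ∈ Finset.range (n + 1), (nodeWeight ρ k : ℂ) *
        ∫ ω, g ω * Complex.exp (s * walk T y k ω * Complex.I) ∂P := by
    rw [e2, integral_finsetSum _ fun k _ => (hi k).const_mul _]
    simp only [integral_const_mul]
  have e3 : (fun ω => g ω * innovation ρ (charFun ν s) (fun v => walk T y v ω) n s) = fun ω =>
      g ω * Complex.exp (s * walk T y (n + 1) ω * Complex.I) -
        charFun ν s / ((n : ℂ) + ρ) * (g ω * expSum ρ (fun v => walk T y v ω) n s) := by
    ext ω
    rw [innovation]
    ring
  rw [e3]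
  refine ⟨(hi _).sub (i2.const_mul _), ?_⟩
  rw [integral_sub (hi _) (i2.const_mul _), integral_const_mul, h3]
  simp only [RCLike.ofReal_eq_complex_ofReal] at h2
  rw [← e1, h2, ← charFun_apply_real, ofReal_totalWeight]
  ring

theorem integral_mul_innovationDeriv (hT : IsWeightedRRT P ρ T)
    (hy : IsOffsetFamily P ν T y) (hν : MemLp id 2 ν) (n : ℕ) (s : ℝ) {g : Ω → ℂ}
    (hg : Measurable[treeFiltration hT.measurable hy.measurable n] g) (hgi : MemLp g 2 P) :
    Integrable (fun ω => g ω *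
      innovationDeriv ρ (charFun ν s) (charFunDeriv ν s) (fun v => walk T y v ω) n s) P ∧
    ∫ ω, g ω *
      innovationDeriv ρ (charFun ν s) (charFunDeriv ν s) (fun v => walk T y v ω) n s ∂P = 0 := by
  have hm (v) := measurable_walk hT.measurable hy.measurable v
  have hx (v) := memLp_walk hT.measurable hy hν v
  have hg1 : Integrable g P := hgi.integrable (by norm_num)
  have hi (v) := integrable_mul_exp hg1 (hm v) s
  have hi' (v) := integrable_mul_mul_exp hgi (hm v) (hx v) s
  have hid : Integrable (fun x : ℝ => (x : ℂ)) ν :=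
    (hν.integrable (by norm_num)).ofReal
  have hmk (k) (hk : k ≤ n) : Measurable[treeFiltration hT.measurable hy.measurable n]
      fun ω => Complex.exp (s * walk T y k ω * Complex.I) := by
    have := measurable_walk_treeFiltration hT.measurable hy.measurable hk
    exact Complex.measurable_exp.comp
        (((Complex.measurable_ofReal.comp this).const_mul _).mul_const _)
  obtain ⟨h1, h2⟩ := integral_newNode hT hy n
    (f := fun k ω => g ω * (walk T y k ω * Complex.I * Complex.exp (s * walk T y k ω * Complex.I)))
    (fun k hk => by
      have := measurable_walk_treeFiltration hT.measurable hy.measurable hk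
      exact hg.mul (((Complex.measurable_ofReal.comp this).mul_const _).mul (hmk k hk)))
    (fun k _ => hi' k) (h := fun x => Complex.exp (s * x * Complex.I)) (by fun_prop)
    (Integrable.of_bound (by fun_prop) 1 (.of_forall fun x => (norm_exp_mul_I _ _).le))
  obtain ⟨h1', h2'⟩ := integral_newNode hT hy n
    (f := fun k ω => g ω * Complex.exp (s * walk T y k ω * Complex.I))
    (fun k hk => hg.mul (hmk k hk))
    (fun k _ => hi k) (h := fun x => (x : ℂ) * Complex.I * Complex.exp (s * x * Complex.I))
    (by fun_prop) (integrable_mul_exp (P := ν) (x := id) (hid.mul_const _) measurable_id s)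
  -- The product rule for the exponential at the new node: differentiating the parent's factor leads
  -- to `φ` times `expSumDeriv`, differentiating the offset's factor to `φ'` times `expSum`.
  have e1 : (fun ω => g ω * (walk T y (n + 1) ω * Complex.I *
        Complex.exp (s * walk T y (n + 1) ω * Complex.I))) =
      fun ω => g ω * (walk T y (T ω n) ω * Complex.I *
        Complex.exp (s * walk T y (T ω n) ω * Complex.I)) *
        Complex.exp (s * y (n + 1) ω * Complex.I) +
      g ω * Complex.exp (s * walk T y (T ω n) ω * Complex.I) *
        ((y (n + 1) ω : ℂ) * Complex.I * Complex.exp (s * y (n + 1) ω * Complex.I)) := by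
    ext ω
    have : Complex.exp (s * walk T y (n + 1) ω * Complex.I) =
        Complex.exp (s * walk T y (T ω n) ω * Complex.I) *
          Complex.exp (s * y (n + 1) ω * Complex.I) := by
      rw [← Complex.exp_add, walk_succ]
      congr 1
      push_cast
      ring
    rw [this, walk_succ]
    push_cast
    ring
  have e2 : (fun ω => g ω * expSum ρ (fun v => walk T y v ω) n s) = fun ω =>
      ∑ k ∈ Finset.range (n + 1), (nodeWeight ρ k : ℂ) *
        (g ω * Complex.exp (s * walk T y k ω * Complex.I)) := by
    ext ω
    rw [expSum, Finset.mul_sum]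
    exact Finset.sum_congr rfl fun k _ => by ring
  have e2' : (fun ω => g ω * expSumDeriv ρ (fun v => walk T y v ω) n s) = fun ω =>
      ∑ k ∈ Finset.range (n + 1), (nodeWeight ρ k : ℂ) *
        (g ω * (walk T y k ω * Complex.I * Complex.exp (s * walk T y k ω * Complex.I))) := by
    ext ω
    rw [expSumDeriv, Finset.mul_sum]
    exact Finset.sum_congr rfl fun k _ => by ring
  have i2 : Integrable (fun ω => g ω * expSum ρ (fun v => walk T y v ω) n s) P := by
    rw [e2]
    exact integrable_finsetSum _ fun k _ => (hi k).const_mul _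
  have i2' : Integrable (fun ω => g ω * expSumDeriv ρ (fun v => walk T y v ω) n s) P := by
    rw [e2']
    exact integrable_finsetSum _ fun k _ => (hi' k).const_mul _
  have h3 : ∫ ω, g ω * expSum ρ (fun v => walk T y v ω) n s ∂P =
      ∑ k ∈ Finset.range (n + 1), (nodeWeight ρ k : ℂ) *
        ∫ ω, g ω * Complex.exp (s * walk T y k ω * Complex.I) ∂P := by
    rw [e2, integral_finsetSum _ fun k _ => (hi k).const_mul _]
    simp only [integral_const_mul]
  have h3' : ∫ ω, g ω * expSumDeriv ρ (fun v => walk T y v ω) n s ∂P =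
      ∑ k ∈ Finset.range (n + 1), (nodeWeight ρ k : ℂ) *
        ∫ ω, g ω * (walk T y k ω * Complex.I *
          Complex.exp (s * walk T y k ω * Complex.I)) ∂P := by
    rw [e2', integral_finsetSum _ fun k _ => (hi' k).const_mul _]
    simp only [integral_const_mul]
  have e3 : (fun ω => g ω *
      innovationDeriv ρ (charFun ν s) (charFunDeriv ν s) (fun v => walk T y v ω) n s) = fun ω =>
      g ω * (walk T y (n + 1) ω * Complex.I * Complex.exp (s * walk T y (n + 1) ω * Complex.I)) -
        (charFun ν s / ((n : ℂ) + ρ) * (g ω * expSumDeriv ρ (fun v => walk T y v ω) n s) +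
        charFunDeriv ν s / ((n : ℂ) + ρ) * (g ω * expSum ρ (fun v => walk T y v ω) n s)) := by
    ext ω
    rw [innovationDeriv]
    ring
  have i3 : Integrable (fun ω =>
      charFun ν s / ((n : ℂ) + ρ) * (g ω * expSumDeriv ρ (fun v => walk T y v ω) n s) +
        charFunDeriv ν s / ((n : ℂ) + ρ) * (g ω * expSum ρ (fun v => walk T y v ω) n s)) P :=
    (i2'.const_mul (charFun ν s / ((n : ℂ) + ρ))).add
    (i2.const_mul (charFunDeriv ν s / ((n : ℂ) + ρ)))
  rw [e3]
  refine ⟨(hi' _).sub i3, ?_⟩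
  rw [integral_sub (hi' _) i3, integral_add (i2'.const_mul _) (i2.const_mul _),
    integral_const_mul, integral_const_mul, h3, h3']
  simp only [RCLike.ofReal_eq_complex_ofReal] at h2 h2'
  rw [e1, integral_add h1 h1', h2, h2', ← charFun_apply_real, ← charFunDeriv, ofReal_totalWeight]
  ring

end Orthogonality

/-! ### The derivative martingale: increments and pointwise bounds -/

section DerivMartingale

variable {ρ : ℝ} {ν : Measure ℝ}

/-- The derivative in `s` of the martingale `normalizer * expSum`. -/
def derivMartingale (ρ : ℝ) (ν : Measure ℝ) (x : ℕ → ℝ) (n : ℕ) (s : ℝ) : ℂ :=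
  normalizer ρ (charFun ν s) n *
    (expSumDeriv ρ x n s - logDerivative ρ (charFun ν s) (charFunDeriv ν s) n * expSum ρ x n s)

theorem hasDerivAt_normalizer_mul_expSum [IsProbabilityMeasure ν] (hρ : 0 < ρ)
    (hν : MemLp id 2 ν) (x : ℕ → ℝ) (n : ℕ) {s : ℝ} (hq : 0 ≤ (charFun ν s).re) :
    HasDerivAt (fun s => normalizer ρ (charFun ν s) n * expSum ρ x n s)
      (derivMartingale ρ ν x n s) s := by
  refine ((hasDerivAt_normalizer hρ (hasDerivAt_charFun hν s) hq n).mul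
    (hasDerivAt_expSum x n s)).congr_deriv ?_
  rw [derivMartingale]
  ring

/-- The increment of `normalizer * expSum` is `normalizer` at `n + 1` times `innovation`. Its
derivative in `s` is the increment here, `innovationDeriv` being the derivative of `innovation` and
`-logDerivative` the logarithmic derivative of `normalizer`. -/
theorem derivMartingale_succ (hρ : 0 < ρ) (x : ℕ → ℝ) (n : ℕ) {s : ℝ}
    (hq : 0 ≤ (charFun ν s).re) :
    derivMartingale ρ ν x (n + 1) s = derivMartingale ρ ν x n s +
      normalizer ρ (charFun ν s) (n + 1) *
        (innovationDeriv ρ (charFun ν s) (charFunDeriv ν s) x n s -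
          logDerivative ρ (charFun ν s) (charFunDeriv ν s) (n + 1) *
            innovation ρ (charFun ν s) x n s) := by
  have h1 := natCast_add_ne_zero hρ n
  have h2 := natCast_add_add_ne_zero hρ hq n
  have h3 : 1 + charFun ν s / ((n : ℂ) + ρ) = ((n : ℂ) + ρ + charFun ν s) / ((n : ℂ) + ρ) := by
    field_simp
  rw [derivMartingale, derivMartingale, innovation, innovationDeriv, expSum_succ, expSumDeriv_succ,
    normalizer_succ hρ hq n, logDerivative_succ, h3]
  field_simp
  ring

theorem one_le_ratio (hρ : 0 < ρ) (n : ℕ) : 1 ≤ ((n : ℝ) + ρ) / ρ := by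
  rw [le_div_iff₀ hρ]
  simp

theorem norm_logDerivative_charFun_le (hρ : 0 < ρ) {s : ℝ} (hq : 0 ≤ (charFun ν s).re) (n : ℕ) :
    ‖logDerivative ρ (charFun ν s) (charFunDeriv ν s) n‖ ≤
      8 * (1 + 1 / ρ) * (∫ x, |x| ∂ν) * (((n : ℝ) + ρ) / ρ) ^ (1 / 8 : ℝ) := by
  refine (norm_logDerivative_le hρ hq n).trans ?_
  gcongr
  exact norm_charFunDeriv_le s

/-- A bound for `derivMartingale` that does not depend on `s`. -/
def derivBound (ρ : ℝ) (ν : Measure ℝ) (x : ℕ → ℝ) (n : ℕ) : ℝ :=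
  ∑ v ∈ Finset.range (n + 1), nodeWeight ρ v * |x v| +
    8 * (1 + 1 / ρ) * (∫ x, |x| ∂ν) * (((n : ℝ) + ρ) / ρ) ^ (1 / 8 : ℝ) * totalWeight ρ n

theorem norm_derivMartingale_le (hρ : 0 < ρ) (x : ℕ → ℝ) (n : ℕ) {s : ℝ}
    (hq : 3 / 4 ≤ (charFun ν s).re) :
    ‖derivMartingale ρ ν x n s‖ ≤ derivBound ρ ν x n := by
  have h1 : ‖normalizer ρ (charFun ν s) n‖ ≤ 1 :=
    (norm_normalizer_le hρ hq n).trans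
      (Real.rpow_le_one_of_one_le_of_nonpos (one_le_ratio hρ n) (by norm_num))
  rw [derivMartingale, norm_mul]
  refine (mul_le_of_le_one_left (norm_nonneg _) h1).trans ((norm_sub_le _ _).trans ?_)
  rw [derivBound, norm_mul]
  have h2 := norm_logDerivative_charFun_le hρ (ν := ν) (s := s) (by linarith) n
  exact add_le_add (norm_expSumDeriv_le hρ x n s)
    (mul_le_mul h2 (norm_expSum_le hρ x n s) (norm_nonneg _) ((norm_nonneg _).trans h2))

theorem measurable_normalizer_charFun [IsProbabilityMeasure ν] {n : ℕ} :
    Measurable fun s : ℝ => normalizer ρ (charFun ν s) n := by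
  unfold normalizer
  have := measurable_charFun (μ := ν)
  fun_prop

theorem measurable_logDerivative_charFun [IsProbabilityMeasure ν] (hν : MemLp id 2 ν) {n : ℕ} :
    Measurable fun s : ℝ => logDerivative ρ (charFun ν s) (charFunDeriv ν s) n := by
  unfold logDerivative
  have := measurable_charFun (μ := ν)
  have := (continuous_charFunDeriv hν).measurable
  fun_prop

theorem measurable_derivMartingale [IsProbabilityMeasure ν] (hν : MemLp id 2 ν)
    {Ω : Type*} [MeasurableSpace Ω] {x : ℕ → Ω → ℝ} {n : ℕ} (hx : ∀ v ≤ n, Measurable (x v)) :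
    Measurable fun p : Ω × ℝ => derivMartingale ρ ν (fun v => x v p.1) n p.2 :=
  (measurable_normalizer_charFun.comp measurable_snd).mul ((measurable_expSumDeriv hx).sub
    (((measurable_logDerivative_charFun hν).comp measurable_snd).mul (measurable_expSum hx)))

theorem measurable_derivMartingale_apply [IsProbabilityMeasure ν] (hν : MemLp id 2 ν)
    (x : ℕ → ℝ) (n : ℕ) : Measurable (derivMartingale ρ ν x n) := by
  have h3 : Measurable (expSum ρ x n) := by unfold expSum; fun_prop
  have h4 : Measurable (expSumDeriv ρ x n) := by unfold expSumDeriv; fun_prop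
  exact measurable_normalizer_charFun.mul (h4.sub ((measurable_logDerivative_charFun hν).mul h3))

theorem measurable_derivMartingale_left
    {Ω : Type*} [MeasurableSpace Ω] {x : ℕ → Ω → ℝ} {n : ℕ} (hx : ∀ v ≤ n, Measurable (x v))
    (s : ℝ) :
    Measurable fun ω => derivMartingale ρ ν (fun v => x v ω) n s := by
  have h3 : Measurable fun ω => expSum ρ (fun v => x v ω) n s := by
    unfold expSum
    refine Finset.measurable_fun_sum _ fun v hv => ?_
    have := hx v (Nat.lt_succ_iff.1 (Finset.mem_range.1 hv))
    fun_prop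
  have h4 : Measurable fun ω => expSumDeriv ρ (fun v => x v ω) n s := by
    unfold expSumDeriv
    refine Finset.measurable_fun_sum _ fun v hv => ?_
    have := hx v (Nat.lt_succ_iff.1 (Finset.mem_range.1 hv))
    fun_prop
  exact (h4.sub (h3.const_mul _)).const_mul _

theorem norm_innovation_le [IsProbabilityMeasure ν] (hρ : 0 < ρ) (x : ℕ → ℝ) (n : ℕ) (s : ℝ) :
    ‖innovation ρ (charFun ν s) x n s‖ ≤ 2 := by
  have hW := totalWeight_pos hρ n
  have h2 : ‖charFun ν s / ((n : ℂ) + ρ) * expSum ρ x n s‖ ≤ 1 := by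
    rw [norm_mul, norm_div, ← ofReal_totalWeight, Complex.norm_real, Real.norm_of_nonneg hW.le]
    calc _ ≤ 1 / totalWeight ρ n * totalWeight ρ n := by
          gcongr
          · exact norm_charFun_le_one s
          · exact norm_expSum_le hρ x n s
      _ = 1 := by field_simp
  refine (norm_sub_le _ _).trans ?_
  rw [norm_exp_mul_I]
  linarith

theorem sq_norm_innovationDeriv_le [IsProbabilityMeasure ν] (hρ : 0 < ρ) (x : ℕ → ℝ) (n : ℕ)
    (s : ℝ) :
    ‖innovationDeriv ρ (charFun ν s) (charFunDeriv ν s) x n s‖ ^ 2 ≤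
      3 * (x (n + 1) ^ 2 +
        (∑ v ∈ Finset.range (n + 1), nodeWeight ρ v * x v ^ 2) / totalWeight ρ n +
        (∫ x, |x| ∂ν) ^ 2) := by
  have hW := totalWeight_pos hρ n
  set a := (∑ v ∈ Finset.range (n + 1), nodeWeight ρ v * |x v|) / totalWeight ρ n
  have h2 : ‖charFun ν s / ((n : ℂ) + ρ) * expSumDeriv ρ x n s‖ ≤ a := by
    rw [norm_mul, norm_div, ← ofReal_totalWeight, Complex.norm_real, Real.norm_of_nonneg hW.le]
    calc _ ≤ 1 / totalWeight ρ n * ∑ v ∈ Finset.range (n + 1), nodeWeight ρ v * |x v| := by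
          gcongr
          · exact norm_charFun_le_one s
          · exact norm_expSumDeriv_le hρ x n s
      _ = a := by rw [one_div_mul_eq_div]
  have h3 : ‖charFunDeriv ν s / ((n : ℂ) + ρ) * expSum ρ x n s‖ ≤ ∫ x, |x| ∂ν := by
    rw [norm_mul, norm_div, ← ofReal_totalWeight, Complex.norm_real, Real.norm_of_nonneg hW.le]
    calc _ ≤ (∫ x, |x| ∂ν) / totalWeight ρ n * totalWeight ρ n := by
          gcongr
          · exact norm_charFunDeriv_le s
          · exact norm_expSum_le hρ x n s
      _ = _ := by field_simp
  have h4 : ‖innovationDeriv ρ (charFun ν s) (charFunDeriv ν s) x n s‖ ≤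
      |x (n + 1)| + (a + ∫ x, |x| ∂ν) := by
    refine (norm_sub_le _ _).trans (add_le_add (le_of_eq ?_)
      ((norm_add_le _ _).trans (add_le_add h2 h3)))
    rw [norm_mul, norm_mul, norm_exp_mul_I]
    simp
  -- Cauchy–Schwarz for the weighted empirical distribution.
  have h5 : a ^ 2 ≤ (∑ v ∈ Finset.range (n + 1), nodeWeight ρ v * x v ^ 2) / totalWeight ρ n := by
    have h6 : (∑ v ∈ Finset.range (n + 1), nodeWeight ρ v * |x v|) ^ 2 ≤
        totalWeight ρ n * ∑ v ∈ Finset.range (n + 1), nodeWeight ρ v * x v ^ 2 := by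
      refine Finset.sum_sq_le_sum_mul_sum_of_sq_le_mul _ (fun v _ => nodeWeight_nonneg hρ v)
        (fun v _ => mul_nonneg (nodeWeight_nonneg hρ v) (sq_nonneg _)) fun v _ => ?_
      rw [mul_pow, sq_abs]
      exact le_of_eq (by ring)
    rw [div_pow, div_le_div_iff₀ (by positivity) hW]
    nlinarith
  calc _ ≤ (|x (n + 1)| + (a + ∫ x, |x| ∂ν)) ^ 2 := by gcongr
    _ ≤ 3 * (|x (n + 1)| ^ 2 + a ^ 2 + (∫ x, |x| ∂ν) ^ 2) := by
        nlinarith [sq_nonneg (|x (n + 1)| - a), sq_nonneg (|x (n + 1)| - ∫ x, |x| ∂ν),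
          sq_nonneg (a - ∫ x, |x| ∂ν)]
    _ ≤ _ := by
        rw [sq_abs]
        gcongr

/-- The martingale stays close to its value at the origin if its derivative is square
integrable. -/
theorem norm_normalizer_mul_expSum_sub_le [IsProbabilityMeasure ν] (hρ : 0 < ρ)
    (hν : MemLp id 2 ν) {δ : ℝ} (hδ : ∀ s ∈ Set.Icc 0 δ, 3 / 4 ≤ (charFun ν s).re) (x : ℕ → ℝ)
    (n : ℕ) {t : ℝ} (ht0 : 0 < t) (htδ : t ≤ δ) :
    ‖normalizer ρ (charFun ν t) n * expSum ρ x n t - ρ‖ ≤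
      √t * (1 + ∫ s in Set.Ioc 0 δ, ‖derivMartingale ρ ν x n s‖ ^ 2) := by
  have hm := measurable_derivMartingale_apply (ρ := ρ) hν x n
  have hi2 : IntegrableOn (fun s => ‖derivMartingale ρ ν x n s‖ ^ 2) (Set.Ioc 0 δ) := by
    refine Measure.integrableOn_of_bounded (M := derivBound ρ ν x n ^ 2) (by simp)
      (hm.norm.pow_const 2).aestronglyMeasurable ?_
    filter_upwards [ae_restrict_mem measurableSet_Ioc] with s hs
    rw [norm_pow, norm_norm]
    gcongr
    exact norm_derivMartingale_le hρ x n (hδ s ⟨hs.1.le, hs.2⟩)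
  have hi1 : IntegrableOn (derivMartingale ρ ν x n) (Set.Ioc 0 t) := by
    refine Measure.integrableOn_of_bounded (M := derivBound ρ ν x n) (by simp)
      hm.aestronglyMeasurable ?_
    filter_upwards [ae_restrict_mem measurableSet_Ioc] with s hs
    exact norm_derivMartingale_le hρ x n (hδ s ⟨hs.1.le, hs.2.trans htδ⟩)
  have hftc := intervalIntegral.integral_eq_sub_of_hasDerivAt
    (f := fun s => normalizer ρ (charFun ν s) n * expSum ρ x n s) (a := 0) (b := t)
    (fun s hs => by
      rw [Set.uIcc_of_le ht0.le] at hs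
      have := hδ s ⟨hs.1, hs.2.trans htδ⟩
      exact hasDerivAt_normalizer_mul_expSum hρ hν x n (by linarith))
    ((intervalIntegrable_iff_integrableOn_Ioc_of_le ht0.le).2 hi1)
  -- At the origin the martingale is constant: `expSum` is the total weight `n + ρ`, and the product
  -- inverted in `normalizer` telescopes to `(n + ρ) / ρ`.
  have h0 : normalizer ρ (charFun ν 0) n * expSum ρ x n 0 = ρ := by
    have h1 := normalizer_inv_mul hρ 1 n
    have h2 : charFun ν 0 = 1 := by simp [charFun_zero]
    have h3 : normalizer ρ 1 n ≠ 0 := by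
      intro h
      simp [h] at h1
    have h4 := natCast_add_ne_zero hρ n
    simp only [sub_self, zero_div, add_zero, Finset.prod_const_one] at h1
    rw [h2, expSum_zero_right, ofReal_totalWeight]
    rw [mul_div_assoc', eq_comm, eq_div_iff h4, one_mul] at h1
    rw [← mul_right_inj' (inv_ne_zero h3), h1, inv_mul_cancel_left₀ h3]
  simp only [h0] at hftc
  rw [← hftc, intervalIntegral.integral_of_le ht0.le]
  have ic : Integrable (fun _ : ℝ => (√t)⁻¹) (volume.restrict (Set.Ioc 0 t)) :=
    integrable_const _
  have iq : Integrable (fun s => √t * ‖derivMartingale ρ ν x n s‖ ^ 2)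
      (volume.restrict (Set.Ioc 0 t)) :=
    (hi2.mono_set (Set.Ioc_subset_Ioc_right htδ)).const_mul _
  have hs0 : 0 < √t := Real.sqrt_pos.2 ht0
  have hst : √t * √t = t := Real.mul_self_sqrt ht0.le
  calc _ ≤ ∫ s in Set.Ioc 0 t, ‖derivMartingale ρ ν x n s‖ := norm_integral_le_integral_norm _
    -- The inequality `a ≤ 1/√t + √t a²` stands in for Cauchy–Schwarz; over an interval of length
    -- `t` the constant term integrates to `√t`.
    _ ≤ ∫ s in Set.Ioc 0 t, ((√t)⁻¹ + √t * ‖derivMartingale ρ ν x n s‖ ^ 2) := by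
        refine setIntegral_mono_on hi1.norm ?_ measurableSet_Ioc fun s hs => ?_
        · exact ic.add iq
        · set a := ‖derivMartingale ρ ν x n s‖
          have h5 : (√t)⁻¹ * √t = 1 := inv_mul_cancel₀ hs0.ne'
          have h6 : 0 < (√t)⁻¹ := by positivity
          have h7 : 0 ≤ (√t)⁻¹ * (1 - √t * a) ^ 2 := by positivity
          have h8 : (√t)⁻¹ * (1 - √t * a) ^ 2 = (√t)⁻¹ - 2 * a + √t * a ^ 2 := by
            field_simp
            ring
          have h9 : 0 ≤ a := norm_nonneg _
          linarith
    _ = √t + √t * ∫ s in Set.Ioc 0 t, ‖derivMartingale ρ ν x n s‖ ^ 2 := by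
        rw [integral_add ic iq, integral_const_mul]
        simp only [integral_const, MeasurableSet.univ, measureReal_restrict_apply,
          Set.univ_inter, Real.volume_real_Ioc_of_le ht0.le, sub_zero, smul_eq_mul]
        congr 1
        rw [← div_eq_mul_inv, Real.div_sqrt]
    _ ≤ _ := by
        rw [mul_add, mul_one]
        gcongr √t + √t * ?_
        exact setIntegral_mono_set hi2 (.of_forall fun s => sq_nonneg _)
          (Set.Ioc_subset_Ioc_right htδ).eventuallyLE

end DerivMartingale

/-! ### Boundedness of the square function of the derivative martingale -/

section SquareFunction

variable {Ω : Type*} [MeasurableSpace Ω] {P : Measure Ω} {ρ : ℝ}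
  {T : Ω → GrowingTree} {ν : Measure ℝ} {y : ℕ → Ω → ℝ}
  [IsProbabilityMeasure P] [IsProbabilityMeasure ν]

theorem memLp_derivBound (hT : Measurable T) (hy : IsOffsetFamily P ν T y) (hν : MemLp id 2 ν)
    (n : ℕ) : MemLp (fun ω => derivBound ρ ν (fun v => walk T y v ω) n) 2 P :=
  (memLp_finsetSum _ fun v _ => (memLp_walk hT hy hν v).abs.const_mul _).add (memLp_const _)

theorem memLp_derivMartingale (hρ : 0 < ρ) (hT : Measurable T) (hy : IsOffsetFamily P ν T y)
    (hν : MemLp id 2 ν) {s : ℝ} (hq : 3 / 4 ≤ (charFun ν s).re) (n : ℕ) :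
    MemLp (fun ω => derivMartingale ρ ν (fun v => walk T y v ω) n s) 2 P := by
  refine (memLp_derivBound (ρ := ρ) hT hy hν n).mono ?_ (.of_forall fun ω =>
    (norm_derivMartingale_le hρ _ n hq).trans (le_abs_self _))
  exact (measurable_derivMartingale_left (fun v _ =>
    measurable_walk hT hy.measurable v) s).aestronglyMeasurable

/-- Pythagoras for the increments of the derivative martingale. -/
theorem setIntegral_sq_norm_derivMartingale_succ (hρ : 0 < ρ) (hT : IsWeightedRRT P ρ T)
    (hy : IsOffsetFamily P ν T y) (hν : MemLp id 2 ν) {s : ℝ} (hq : 3 / 4 ≤ (charFun ν s).re)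
    (n : ℕ) {A : Set Ω} (hA : MeasurableSet[treeFiltration hT.measurable hy.measurable n] A) :
    ∫ ω in A, ‖derivMartingale ρ ν (fun v => walk T y v ω) (n + 1) s‖ ^ 2 ∂P =
      ∫ ω in A, ‖derivMartingale ρ ν (fun v => walk T y v ω) n s‖ ^ 2 ∂P +
      ∫ ω in A, ‖derivMartingale ρ ν (fun v => walk T y v ω) (n + 1) s -
        derivMartingale ρ ν (fun v => walk T y v ω) n s‖ ^ 2 ∂P := by
  set D : ℕ → Ω → ℂ := fun n ω => derivMartingale ρ ν (fun v => walk T y v ω) n s with hD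
  have hDL (n) : MemLp (D n) 2 P := memLp_derivMartingale hρ hT.measurable hy hν hq n
  have hAm : MeasurableSet A := (treeFiltration hT.measurable hy.measurable).le n A hA
  have hDm : Measurable[treeFiltration hT.measurable hy.measurable n] (D n) :=
    @measurable_derivMartingale_left ρ ν Ω
      (treeFiltration hT.measurable hy.measurable n) (fun v => walk T y v) n
      (fun v hv => measurable_walk_treeFiltration hT.measurable hy.measurable hv) s
  -- The conjugate of `D n` cut off to `A` is measurable with respect to the past and in `L²`, so
  -- both innovations are orthogonal to it; this kills the cross term.
  let g : Ω → ℂ := A.indicator fun ω => (starRingEnd ℂ) (D n ω)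
  have hgm : Measurable[treeFiltration hT.measurable hy.measurable n] g :=
    Measurable.indicator (Complex.continuous_conj.measurable.comp hDm) hA
  have hgL : MemLp g 2 P := (hDL n).star.indicator hAm
  obtain ⟨i1, e1⟩ := integral_mul_innovation hT hy n s hgm (hgL.integrable (by norm_num))
  obtain ⟨i2, e2⟩ := integral_mul_innovationDeriv hT hy hν n s hgm hgL
  have hcross : ∫ ω, g ω * (D (n + 1) ω - D n ω) ∂P = 0 := by
    have h1 : (fun ω => g ω * (D (n + 1) ω - D n ω)) = fun ω =>
        normalizer ρ (charFun ν s) (n + 1) * (g ω *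
          innovationDeriv ρ (charFun ν s) (charFunDeriv ν s) (fun v => walk T y v ω) n s) -
        normalizer ρ (charFun ν s) (n + 1) *
          logDerivative ρ (charFun ν s) (charFunDeriv ν s) (n + 1) * (g ω *
            innovation ρ (charFun ν s) (fun v => walk T y v ω) n s) := by
      ext ω
      simp only [hD]
      rw [derivMartingale_succ hρ _ n (by linarith)]
      ring
    rw [h1, integral_sub (i2.const_mul _) (i1.const_mul _), integral_const_mul, integral_const_mul,
      e1, e2]
    simp
  have hΔ : MemLp (fun ω => D (n + 1) ω - D n ω) 2 P := (hDL (n + 1)).sub (hDL n)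
  have hcross' : ∫ ω in A, ((starRingEnd ℂ) (D n ω) * (D (n + 1) ω - D n ω)).re ∂P = 0 := by
    have hi : Integrable (fun ω => (starRingEnd ℂ) (D n ω) * (D (n + 1) ω - D n ω)) P :=
      (hDL n).star.integrable_mul hΔ
    have h2 : ∫ ω in A, (starRingEnd ℂ) (D n ω) * (D (n + 1) ω - D n ω) ∂P = 0 := by
      rw [← integral_indicator hAm, ← hcross]
      congr 1
      ext ω
      by_cases h : ω ∈ A <;> simp [g, h]
    have h3 := integral_re hi.integrableOn (μ := P.restrict A)
    simp only [RCLike.re_eq_complex_re] at h3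
    rw [h3, h2, Complex.zero_re]
  have hpt (ω : Ω) : ‖D (n + 1) ω‖ ^ 2 = ‖D n ω‖ ^ 2 + ‖D (n + 1) ω - D n ω‖ ^ 2 +
      2 * ((starRingEnd ℂ) (D n ω) * (D (n + 1) ω - D n ω)).re := by
    simp only [← Complex.normSq_eq_norm_sq, Complex.normSq_apply, Complex.mul_re, Complex.conj_re,
      Complex.conj_im, Complex.sub_re, Complex.sub_im]
    ring
  have j1 : IntegrableOn (fun ω => ‖D n ω‖ ^ 2) A P := (hDL n).norm.integrable_sq.integrableOn
  have j2 : IntegrableOn (fun ω => ‖D (n + 1) ω - D n ω‖ ^ 2) A P :=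
    hΔ.norm.integrable_sq.integrableOn
  have j3 : IntegrableOn
      (fun ω => 2 * ((starRingEnd ℂ) (D n ω) * (D (n + 1) ω - D n ω)).re) A P := by
    have hi : Integrable (fun ω => (starRingEnd ℂ) (D n ω) * (D (n + 1) ω - D n ω)) P :=
      (hDL n).star.integrable_mul hΔ
    exact (hi.re.const_mul 2).integrableOn
  have j4 : IntegrableOn (fun ω => ‖D n ω‖ ^ 2 + ‖D (n + 1) ω - D n ω‖ ^ 2) A P := j1.add j2
  calc _ = ∫ ω in A, (‖D n ω‖ ^ 2 + ‖D (n + 1) ω - D n ω‖ ^ 2 +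
      2 * ((starRingEnd ℂ) (D n ω) * (D (n + 1) ω - D n ω)).re) ∂P :=
        integral_congr_ae (.of_forall hpt)
    _ = _ := by
        rw [integral_add j4 j3, integral_add j1 j2, integral_const_mul, hcross', mul_zero, add_zero]

/-- The increments of the derivative martingale decay polynomially in mean square. -/
theorem exists_integral_sq_norm_increment_le (hρ : 0 < ρ) (hT : IsWeightedRRT P ρ T)
    (hy : IsOffsetFamily P ν T y) (hν : MemLp id 2 ν) :
    ∃ K : ℝ, 0 ≤ K ∧ ∀ (n : ℕ) (s : ℝ), 3 / 4 ≤ (charFun ν s).re →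
      ∫ ω, ‖derivMartingale ρ ν (fun v => walk T y v ω) (n + 1) s -
        derivMartingale ρ ν (fun v => walk T y v ω) n s‖ ^ 2 ∂P ≤
          K * ((((n + 1 : ℕ) : ℝ) + ρ) / ρ) ^ (-(5 / 4) : ℝ) := by
  set m₁ := ∫ x, |x| ∂ν
  set m₂ := ∫ x, x ^ 2 ∂ν
  have hm₂ : 0 ≤ m₂ := integral_nonneg fun x => sq_nonneg x
  set c := 8 * (1 + 1 / ρ) * m₁
  -- From `‖a - l b‖² ≤ 2‖a‖² + 8‖l‖²` when `‖b‖ ≤ 2`, with `‖a‖² ≤ V`. The mean of `V` contains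
  -- `meanSquare` once directly and `5/4` times through the new node, hence `9/4`. The exponents
  -- combine to `-3/2 + 1/4 = -5/4`, which is summable.
  refine ⟨6 * (9 / 4 * (20 * m₂) + 5 * m₂ + m₁ ^ 2) + 8 * c ^ 2, by positivity, fun n s hq => ?_⟩
  have hx (v) := memLp_walk hT.measurable hy hν v
  set R : ℝ := (((n + 1 : ℕ) : ℝ) + ρ) / ρ with hR
  have hR1 : 1 ≤ R := one_le_ratio hρ _
  have hR0 : 0 < R := by linarith
  have hRq : 1 ≤ R ^ (1 / 4 : ℝ) := Real.one_le_rpow hR1 (by norm_num)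
  have hC : ‖normalizer ρ (charFun ν s) (n + 1)‖ ^ 2 ≤ R ^ (-(3 / 2) : ℝ) := by
    calc _ ≤ (R ^ (-(3 / 4) : ℝ)) ^ 2 := by
          gcongr
          exact norm_normalizer_le hρ hq (n + 1)
      _ = _ := by
          rw [← Real.rpow_natCast, ← Real.rpow_mul hR0.le]
          norm_num
  have hL : ‖logDerivative ρ (charFun ν s) (charFunDeriv ν s) (n + 1)‖ ^ 2 ≤
      c ^ 2 * R ^ (1 / 4 : ℝ) := by
    calc _ ≤ (c * R ^ (1 / 8 : ℝ)) ^ 2 := by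
          gcongr
          exact norm_logDerivative_charFun_le hρ (by linarith) (n + 1)
      _ = _ := by
          rw [mul_pow, ← Real.rpow_natCast (R ^ (1 / 8 : ℝ)), ← Real.rpow_mul hR0.le]
          norm_num
  let V : Ω → ℝ := fun ω => 3 * (walk T y (n + 1) ω ^ 2 +
    (∑ v ∈ Finset.range (n + 1), nodeWeight ρ v * walk T y v ω ^ 2) / totalWeight ρ n + m₁ ^ 2)
  have i1 := (hx (n + 1)).integrable_sq
  have i2 : Integrable (fun ω => ∑ v ∈ Finset.range (n + 1), nodeWeight ρ v * walk T y v ω ^ 2) P :=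
    integrable_finsetSum _ fun v _ => (hx v).integrable_sq.const_mul _
  have i12 : Integrable (fun ω => walk T y (n + 1) ω ^ 2 +
    (∑ v ∈ Finset.range (n + 1), nodeWeight ρ v * walk T y v ω ^ 2) / totalWeight ρ n) P :=
    i1.add (i2.div_const _)
  have iV : Integrable V P := (i12.add (integrable_const _)).const_mul 3
  have hV : ∫ ω, V ω ∂P ≤ 3 * (9 / 4 * (20 * m₂) + 5 * m₂ + m₁ ^ 2) * R ^ (1 / 4 : ℝ) := by
    have hB : meanSquare P ρ (walk T y) n ≤ 20 * m₂ * R ^ (1 / 4 : ℝ) := by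
      refine (meanSquare_le hρ hT hy hν n).trans ?_
      have : ((n : ℝ) + ρ) / ρ ≤ R := by
        rw [hR]
        gcongr
        simp
      gcongr
    have h1 := integral_walk_succ_sq_le hT hy hν n
    have h2 : ∫ ω, V ω ∂P = 3 * (∫ ω, walk T y (n + 1) ω ^ 2 ∂P + meanSquare P ρ (walk T y) n +
        m₁ ^ 2) := by
      simp only [V]
      rw [integral_const_mul, integral_add i12 (integrable_const _),
        integral_add i1 (i2.div_const _),
        integral_div, integral_finsetSum _ fun v _ => (hx v).integrable_sq.const_mul _, meanSquare]
      simp only [integral_const_mul]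
      simp
    rw [h2]
    nlinarith [mul_nonneg hm₂ (sub_nonneg.2 hRq), mul_nonneg (sq_nonneg m₁) (sub_nonneg.2 hRq)]
  have hpt (ω : Ω) : ‖derivMartingale ρ ν (fun v => walk T y v ω) (n + 1) s -
        derivMartingale ρ ν (fun v => walk T y v ω) n s‖ ^ 2 ≤
      R ^ (-(3 / 2) : ℝ) * (2 * V ω + 8 * c ^ 2 * R ^ (1 / 4 : ℝ)) := by
    rw [derivMartingale_succ hρ _ n (by linarith), add_sub_cancel_left, norm_mul, mul_pow]
    have hN' := sq_norm_innovationDeriv_le (ν := ν) hρ (fun v => walk T y v ω) n s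
    have hN := norm_innovation_le (ν := ν) hρ (fun v => walk T y v ω) n s
    gcongr
    set a := innovationDeriv ρ (charFun ν s) (charFunDeriv ν s) (fun v => walk T y v ω) n s
    set b := innovation ρ (charFun ν s) (fun v => walk T y v ω) n s
    set l := logDerivative ρ (charFun ν s) (charFunDeriv ν s) (n + 1)
    have h1 : ‖a - l * b‖ ≤ ‖a‖ + ‖l‖ * 2 := by
      refine (norm_sub_le _ _).trans ?_
      rw [norm_mul]
      gcongr
    calc ‖a - l * b‖ ^ 2 ≤ (‖a‖ + ‖l‖ * 2) ^ 2 := by gcongr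
      _ ≤ 2 * ‖a‖ ^ 2 + 8 * ‖l‖ ^ 2 := by nlinarith [sq_nonneg (‖a‖ - ‖l‖ * 2)]
      _ ≤ 2 * V ω + 8 * (c ^ 2 * R ^ (1 / 4 : ℝ)) := by
          gcongr
      _ = _ := by ring
  have hD := ((memLp_derivMartingale hρ hT.measurable hy hν hq (n + 1)).sub
    (memLp_derivMartingale hρ hT.measurable hy hν hq n)).norm.integrable_sq
  calc _ ≤ ∫ ω, R ^ (-(3 / 2) : ℝ) * (2 * V ω + 8 * c ^ 2 * R ^ (1 / 4 : ℝ)) ∂P :=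
        integral_mono hD (((iV.const_mul 2).add (integrable_const _)).const_mul _) hpt
    _ = R ^ (-(3 / 2) : ℝ) * (2 * ∫ ω, V ω ∂P + 8 * c ^ 2 * R ^ (1 / 4 : ℝ)) := by
        rw [integral_const_mul, integral_add (iV.const_mul 2) (integrable_const _),
          integral_const_mul]
        simp
    _ ≤ R ^ (-(3 / 2) : ℝ) * (2 * (3 * (9 / 4 * (20 * m₂) + 5 * m₂ + m₁ ^ 2) * R ^ (1 / 4 : ℝ)) +
        8 * c ^ 2 * R ^ (1 / 4 : ℝ)) := by gcongr
    _ = (6 * (9 / 4 * (20 * m₂) + 5 * m₂ + m₁ ^ 2) + 8 * c ^ 2) *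
        (R ^ (-(3 / 2) : ℝ) * R ^ (1 / 4 : ℝ)) := by ring
    _ = _ := by
        rw [← Real.rpow_add hR0]
        norm_num

theorem summable_ratio_rpow (hρ : 0 < ρ) :
    Summable fun n : ℕ => ((((n + 1 : ℕ) : ℝ) + ρ) / ρ) ^ (-(5 / 4) : ℝ) := by
  have h1 : Summable fun n : ℕ => (((n + 1 : ℕ) : ℝ)) ^ (-(5 / 4) : ℝ) :=
    (summable_nat_add_iff 1).2 (Real.summable_nat_rpow.2 (by norm_num))
  refine Summable.of_nonneg_of_le (fun n => by positivity) (fun n => ?_)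
    (h1.mul_left (ρ⁻¹ ^ (-(5 / 4) : ℝ)))
  rw [div_eq_inv_mul, Real.mul_rpow (by positivity) (by positivity)]
  gcongr ?_ * ?_
  exact Real.rpow_le_rpow_of_nonpos (by positivity) (by linarith) (by norm_num)

/-- The martingale starts at `0`, since the root sits at the origin, so by orthogonality its second
moment is the sum of those of its increments, and these are summable uniformly in `s`. -/
theorem exists_integral_sq_norm_derivMartingale_le (hρ : 0 < ρ) (hT : IsWeightedRRT P ρ T)
    (hy : IsOffsetFamily P ν T y) (hν : MemLp id 2 ν) :
    ∃ K : ℝ, 0 ≤ K ∧ ∀ (n : ℕ) (s : ℝ), 3 / 4 ≤ (charFun ν s).re →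
      ∫ ω, ‖derivMartingale ρ ν (fun v => walk T y v ω) n s‖ ^ 2 ∂P ≤ K := by
  obtain ⟨K, hK, h⟩ := exists_integral_sq_norm_increment_le hρ hT hy hν
  have hs := summable_ratio_rpow hρ
  refine ⟨K * ∑' n : ℕ, ((((n + 1 : ℕ) : ℝ) + ρ) / ρ) ^ (-(5 / 4) : ℝ),
    mul_nonneg hK (tsum_nonneg fun n => by positivity), fun n s hq => ?_⟩
  have key : ∫ ω, ‖derivMartingale ρ ν (fun v => walk T y v ω) n s‖ ^ 2 ∂P ≤
      K * ∑ k ∈ Finset.range n, ((((k + 1 : ℕ) : ℝ) + ρ) / ρ) ^ (-(5 / 4) : ℝ) := by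
    induction n with
    | zero =>
      have (ω : Ω) : walk T y 0 ω = 0 := position_zero _ _
      simp [derivMartingale, expSumDeriv, logDerivative, this]
    | succ n ih =>
      have h1 := setIntegral_sq_norm_derivMartingale_succ hρ hT hy hν hq n (A := Set.univ)
        MeasurableSet.univ
      simp only [Measure.restrict_univ] at h1
      rw [h1, Finset.sum_range_succ, mul_add]
      exact add_le_add ih (h n s hq)
  refine key.trans ?_
  gcongr
  exact hs.sum_le_tsum _ fun k _ => by positivity

/-- The squared norm of the derivative martingale in `L²(0, δ)`. -/
def squareFunction (ρ : ℝ) (ν : Measure ℝ) (δ : ℝ) (x : ℕ → ℝ) (n : ℕ) : ℝ :=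
  ∫ s in Set.Ioc 0 δ, ‖derivMartingale ρ ν x n s‖ ^ 2

theorem stronglyMeasurable_squareFunction (hν : MemLp id 2 ν) (δ : ℝ) {Ω : Type*}
    [MeasurableSpace Ω] {x : ℕ → Ω → ℝ} {n : ℕ} (hx : ∀ v ≤ n, Measurable (x v)) :
    StronglyMeasurable fun ω => squareFunction ρ ν δ (fun v => x v ω) n :=
  StronglyMeasurable.integral_prod_right'
    (f := fun p : Ω × ℝ => ‖derivMartingale ρ ν (fun v => x v p.1) n p.2‖ ^ 2)
    ((measurable_derivMartingale hν hx).norm.pow_const 2).stronglyMeasurable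

theorem integrable_prod_sq_norm_derivMartingale (hρ : 0 < ρ) (hT : Measurable T)
    (hy : IsOffsetFamily P ν T y) (hν : MemLp id 2 ν) {δ : ℝ}
    (hδ : ∀ s ∈ Set.Icc 0 δ, 3 / 4 ≤ (charFun ν s).re) (n : ℕ) (A : Set Ω) :
    Integrable (fun p : Ω × ℝ => ‖derivMartingale ρ ν (fun v => walk T y v p.1) n p.2‖ ^ 2)
      ((P.restrict A).prod (volume.restrict (Set.Ioc 0 δ))) := by
  have h1 : Integrable (fun ω => derivBound ρ ν (fun v => walk T y v ω) n ^ 2) (P.restrict A) :=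
    (memLp_derivBound hT hy hν n).integrable_sq.integrableOn
  refine (h1.comp_fst (volume.restrict (Set.Ioc 0 δ))).mono'
    ((measurable_derivMartingale hν fun v _ =>
      measurable_walk hT hy.measurable v).norm.pow_const 2).aestronglyMeasurable ?_
  have h2 : ∀ᵐ p ∂((P.restrict A).prod (volume.restrict (Set.Ioc 0 δ))), p.2 ∈ Set.Ioc 0 δ :=
    Measure.quasiMeasurePreserving_snd.ae (ae_restrict_mem measurableSet_Ioc)
  filter_upwards [h2] with p hp
  rw [norm_pow, norm_norm]
  gcongr
  exact norm_derivMartingale_le hρ _ n (hδ _ ⟨hp.1.le, hp.2⟩)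

theorem setIntegral_squareFunction (hρ : 0 < ρ) (hT : Measurable T)
    (hy : IsOffsetFamily P ν T y) (hν : MemLp id 2 ν) {δ : ℝ}
    (hδ : ∀ s ∈ Set.Icc 0 δ, 3 / 4 ≤ (charFun ν s).re) (n : ℕ) (A : Set Ω) :
    ∫ ω in A, squareFunction ρ ν δ (fun v => walk T y v ω) n ∂P =
      ∫ s in Set.Ioc 0 δ, ∫ ω in A, ‖derivMartingale ρ ν (fun v => walk T y v ω) n s‖ ^ 2 ∂P :=
  integral_integral_swap (integrable_prod_sq_norm_derivMartingale hρ hT hy hν hδ n A)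

/-- Fubini brings the integral over a past event inside the integral over `s`, where Pythagoras
gives monotonicity for each `s`. -/
theorem submartingale_squareFunction (hρ : 0 < ρ) (hT : IsWeightedRRT P ρ T)
    (hy : IsOffsetFamily P ν T y) (hν : MemLp id 2 ν) {δ : ℝ}
    (hδ : ∀ s ∈ Set.Icc 0 δ, 3 / 4 ≤ (charFun ν s).re) :
    Submartingale (fun n ω => squareFunction ρ ν δ (fun v => walk T y v ω) n)
      (treeFiltration hT.measurable hy.measurable) P := by
  refine submartingale_of_setIntegral_le_succ (fun n => ?_) (fun n => ?_) fun n A hA => ?_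
  · exact @stronglyMeasurable_squareFunction ρ ν _ hν δ Ω
      (treeFiltration hT.measurable hy.measurable n) (fun v => walk T y v) n
      fun v hv => measurable_walk_treeFiltration hT.measurable hy.measurable hv
  · have := (integrable_prod_sq_norm_derivMartingale hρ hT.measurable hy hν hδ n
      Set.univ).integral_prod_left
    rwa [Measure.restrict_univ] at this
  · rw [setIntegral_squareFunction hρ hT.measurable hy hν hδ,
      setIntegral_squareFunction hρ hT.measurable hy hν hδ]
    refine setIntegral_mono_on
      (integrable_prod_sq_norm_derivMartingale hρ hT.measurable hy hν hδ n A).integral_prod_right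
      (integrable_prod_sq_norm_derivMartingale hρ hT.measurable hy hν hδ (n + 1)
        A).integral_prod_right measurableSet_Ioc fun s hs => ?_
    rw [setIntegral_sq_norm_derivMartingale_succ hρ hT hy hν (hδ s ⟨hs.1.le, hs.2⟩) n hA]
    exact le_add_of_nonneg_right (integral_nonneg fun ω => sq_nonneg _)

/-- A submartingale bounded in `L¹` converges almost surely. -/
theorem ae_bddAbove_squareFunction (hρ : 0 < ρ) (hT : IsWeightedRRT P ρ T)
    (hy : IsOffsetFamily P ν T y) (hν : MemLp id 2 ν) {δ : ℝ}
    (hδ : ∀ s ∈ Set.Icc 0 δ, 3 / 4 ≤ (charFun ν s).re) :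
    ∀ᵐ ω ∂P, BddAbove (Set.range fun n => squareFunction ρ ν δ (fun v => walk T y v ω) n) := by
  obtain ⟨K, hK, h⟩ := exists_integral_sq_norm_derivMartingale_le hρ hT hy hν
  have hsub := submartingale_squareFunction hρ hT hy hν hδ
  have hnn (n : ℕ) (ω : Ω) : 0 ≤ squareFunction ρ ν δ (fun v => walk T y v ω) n :=
    integral_nonneg fun s => sq_nonneg _
  have hbdd (n : ℕ) : eLpNorm (fun ω => squareFunction ρ ν δ (fun v => walk T y v ω) n) 1 P ≤
      ((K * volume.real (Set.Ioc 0 δ)).toNNReal : ENNReal) := by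
    rw [eLpNorm_one_eq_lintegral_enorm, ← ofReal_integral_norm_eq_lintegral_enorm
      (hsub.integrable n)]
    refine ENNReal.ofReal_le_ofReal ?_
    simp only [Real.norm_of_nonneg (hnn n _)]
    have h1 := setIntegral_squareFunction hρ hT.measurable hy hν hδ n Set.univ
    simp only [Measure.restrict_univ] at h1
    have h2 := (integrable_prod_sq_norm_derivMartingale hρ hT.measurable hy hν hδ n
      Set.univ).integral_prod_right
    simp only [Measure.restrict_univ] at h2
    rw [h1]
    calc _ ≤ ∫ s in Set.Ioc 0 δ, K :=
          setIntegral_mono_on h2 (integrableOn_const (by simp)) measurableSet_Ioc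
            fun s hs => h n s (hδ s ⟨hs.1.le, hs.2⟩)
      _ = _ := by simp [mul_comm]
  filter_upwards [hsub.ae_tendsto_limitProcess hbdd] with ω hω
  exact hω.bddAbove_range

end SquareFunction

/-! ### The limit theorem for real offsets -/

section ScalarLimit

variable {Ω : Type*} [MeasurableSpace Ω] {P : Measure Ω} {ρ : ℝ}
  {T : Ω → GrowingTree} {ν : Measure ℝ} {y : ℕ → Ω → ℝ}
  [IsProbabilityMeasure P] [IsProbabilityMeasure ν]

/-- The central limit theorem for the empirical characteristic function of a real branching
walk, at a fixed argument. -/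
theorem ae_tendsto_expSum (hρ : 0 < ρ) (hT : IsWeightedRRT P ρ T)
    (hy : IsOffsetFamily P ν T y) (hν : MemLp id 2 ν) :
    ∀ᵐ ω ∂P, Tendsto (fun n : ℕ =>
      Complex.exp (-((∫ x, x ∂ν : ℝ) * √(Real.log n) * Complex.I)) *
        (expSum ρ (fun v => walk T y v ω) n (√(Real.log n))⁻¹ / ((n : ℂ) + ρ)))
      atTop (𝓝 (Complex.exp (-((∫ x, x ^ 2 ∂ν : ℝ) : ℂ) / 2))) := by
  obtain ⟨δ, hδ0, hδ⟩ : ∃ δ > 0, ∀ s ∈ Set.Icc 0 δ, 3 / 4 ≤ (charFun ν s).re := by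
    have hc : ContinuousAt (fun s => (charFun ν s).re) 0 :=
      (Complex.continuous_re.comp continuous_charFun).continuousAt
    have h1 : ∀ᶠ s in 𝓝 (0 : ℝ), 3 / 4 < (charFun ν s).re :=
      hc.eventually_const_lt (by simp [charFun_zero]; norm_num)
    obtain ⟨ε, hε, h2⟩ := Metric.eventually_nhds_iff.1 h1
    refine ⟨ε / 2, by positivity, fun s hs => (h2 ?_).le⟩
    rw [Real.dist_eq, sub_zero, abs_of_nonneg hs.1]
    linarith [hs.2]
  filter_upwards [ae_bddAbove_squareFunction hρ hT hy hν hδ] with ω ⟨B, hB⟩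
  set x : ℕ → ℝ := fun v => walk T y v ω
  have ht := tendsto_inv_sqrt_log
  have ht0 : Tendsto (fun n : ℕ => (√(Real.log n))⁻¹) atTop (𝓝 0) :=
    tendsto_nhds_of_tendsto_nhdsWithin ht
  have hev : ∀ᶠ n : ℕ in atTop, 0 < (√(Real.log n))⁻¹ ∧ (√(Real.log n))⁻¹ ≤ δ :=
    (ht.eventually self_mem_nhdsWithin).and ((ht0.eventually_lt_const hδ0).mono fun _ h => h.le)
  -- The bound `√t (1 + B)` holds for all `n` with the same `B`, so `t` may depend on `n`.
  have hM : Tendsto (fun n : ℕ => normalizer ρ (charFun ν (√(Real.log n))⁻¹) n *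
      expSum ρ x n (√(Real.log n))⁻¹) atTop (𝓝 ρ) := by
    rw [tendsto_iff_norm_sub_tendsto_zero]
    have hlim : Tendsto (fun n : ℕ => √(√(Real.log n))⁻¹ * (1 + B)) atTop (𝓝 0) := by
      have := ((Real.continuous_sqrt.tendsto 0).comp ht0).mul_const (1 + B)
      simpa using this
    refine squeeze_zero' (.of_forall fun n => norm_nonneg _) ?_ hlim
    filter_upwards [hev] with n hn
    refine (norm_normalizer_mul_expSum_sub_le hρ hν hδ x n hn.1 hn.2).trans ?_
    gcongr
    exact hB ⟨n, rfl⟩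
  have hρ' : (ρ : ℂ) ≠ 0 := by exact_mod_cast hρ.ne'
  have h := (tendsto_normalizer_inv_sqrt_log hρ hν).mul (hM.div_const (ρ : ℂ))
  rw [div_self hρ', mul_one] at h
  refine h.congr' ?_
  filter_upwards [hev] with n hn
  have h1 : normalizer ρ (charFun ν (√(Real.log n))⁻¹) n ≠ 0 := by
    have h0 := hδ _ ⟨hn.1.le, hn.2⟩
    exact inv_ne_zero (Finset.prod_ne_zero_iff.2 fun k _ =>
      factor_ne_zero hρ (by linarith) k)
  have h2 := natCast_add_ne_zero hρ n
  generalize (√(Real.log n))⁻¹ = t at h1 ⊢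
  field_simp

end ScalarLimit

/-! ### Characteristic functions of rescaled empirical distributions -/

section Empirical

variable {d : ℕ} {ρ : ℝ}

theorem charFun_weightedEmpirical (hρ : 0 < ρ) (x : ℕ → EuclideanSpace ℝ (Fin d)) (n : ℕ)
    (t : EuclideanSpace ℝ (Fin d)) :
    charFun (weightedEmpirical ρ hρ x n : Measure (EuclideanSpace ℝ (Fin d))) t =
      (∑ v ∈ Finset.range (n + 1),
        (nodeWeight ρ v : ℂ) * Complex.exp (inner ℝ (x v) t * Complex.I)) / ((n : ℂ) + ρ) := by
  have hW := totalWeight_pos hρ n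
  have hi (v : ℕ) : Integrable (fun z : EuclideanSpace ℝ (Fin d) =>
      Complex.exp (inner ℝ z t * Complex.I))
      (ENNReal.ofReal (nodeWeight ρ v) • Measure.dirac (x v)) :=
    (integrable_dirac (by finiteness)).smul_measure (by finiteness)
  rw [charFun_apply]
  simp only [weightedEmpirical, ProbabilityMeasure.coe_mk]
  rw [integral_smul_measure, integral_finsetSum_measure fun v _ => hi v]
  simp only [integral_smul_measure, integral_dirac, ENNReal.toReal_inv,
    ENNReal.toReal_ofReal hW.le, ENNReal.toReal_ofReal (nodeWeight_nonneg hρ _),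
    Complex.real_smul]
  rw [Complex.ofReal_inv, ofReal_totalWeight, div_eq_inv_mul]

theorem charFun_rescale (a : ℝ) (b : EuclideanSpace ℝ (Fin d))
    (μ : ProbabilityMeasure (EuclideanSpace ℝ (Fin d))) (t : EuclideanSpace ℝ (Fin d)) :
    charFun (rescale a b μ : Measure (EuclideanSpace ℝ (Fin d))) t =
      Complex.exp (-((a⁻¹ * inner ℝ b t : ℝ) * Complex.I)) *
        charFun (μ : Measure (EuclideanSpace ℝ (Fin d))) (a⁻¹ • t) := by
  rw [charFun_apply, charFun_apply, rescale, ProbabilityMeasure.toMeasure_map,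
    integral_map (by fun_prop) (by fun_prop), ← integral_const_mul]
  congr 1
  ext x
  rw [← Complex.exp_add, inner_smul_left, inner_smul_right, inner_sub_left]
  congr 1
  simp
  ring

theorem charFun_rescale_weightedEmpirical (hρ : 0 < ρ) (x : ℕ → EuclideanSpace ℝ (Fin d)) (n : ℕ)
    (b t : EuclideanSpace ℝ (Fin d)) :
    charFun (rescale (√(Real.log n)) (Real.log n • b) (weightedEmpirical ρ hρ x n) :
        Measure (EuclideanSpace ℝ (Fin d))) t =
      Complex.exp (-((inner ℝ b t : ℝ) * √(Real.log n) * Complex.I)) *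
        (expSum ρ (fun v => inner ℝ (x v) t) n (√(Real.log n))⁻¹ / ((n : ℂ) + ρ)) := by
  have h1 : (√(Real.log n))⁻¹ * inner ℝ (Real.log n • b) t = inner ℝ b t * √(Real.log n) := by
    rw [real_inner_smul_left, ← mul_assoc, inv_mul_eq_div, Real.div_sqrt, mul_comm]
  rw [charFun_rescale, charFun_weightedEmpirical, h1, expSum]
  congr 2
  · push_cast
    rfl
  · refine Finset.sum_congr rfl fun v _ => ?_
    rw [real_inner_smul_right]
    push_cast
    rfl

end Empirical

/-! ### The Gaussian limit law -/

section Gaussian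

variable {d : ℕ} {ν : Measure (EuclideanSpace ℝ (Fin d))}

theorem integrable_coord_mul_coord (hν : Integrable (fun x => ‖x‖ ^ 2) ν) (i j : Fin d) :
    Integrable (fun x : EuclideanSpace ℝ (Fin d) => x i * x j) ν := by
  refine hν.mono' (by fun_prop) (.of_forall fun x => ?_)
  rw [norm_mul, sq]
  exact mul_le_mul (PiLp.norm_apply_le x i) (PiLp.norm_apply_le x j) (norm_nonneg _) (norm_nonneg _)

theorem dotProduct_secondMoment_mulVec (hν : Integrable (fun x => ‖x‖ ^ 2) ν) (t : Fin d → ℝ) :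
    t ⬝ᵥ (secondMoment ν).mulVec t = ∫ x, (inner ℝ x (WithLp.toLp 2 t)) ^ 2 ∂ν := by
  have h1 (x : EuclideanSpace ℝ (Fin d)) : (inner ℝ x (WithLp.toLp 2 t)) ^ 2 =
      ∑ i, ∑ j, t i * t j * (x i * x j) := by
    rw [sq, PiLp.inner_apply, Finset.sum_mul_sum]
    refine Finset.sum_congr rfl fun i _ => Finset.sum_congr rfl fun j _ => ?_
    simp
    ring
  simp only [h1]
  rw [integral_finsetSum _ fun i _ => integrable_finsetSum _ fun j _ =>
    (integrable_coord_mul_coord hν i j).const_mul _]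
  simp only [dotProduct, Matrix.mulVec, secondMoment, Matrix.of_apply, Finset.mul_sum]
  refine Finset.sum_congr rfl fun i _ => ?_
  rw [integral_finsetSum _ fun j _ => (integrable_coord_mul_coord hν i j).const_mul _]
  refine Finset.sum_congr rfl fun j _ => ?_
  rw [integral_const_mul]
  ring

theorem posSemidef_secondMoment (hν : Integrable (fun x => ‖x‖ ^ 2) ν) :
    (secondMoment ν).PosSemidef := by
  refine .of_dotProduct_mulVec_nonneg ?_ fun t => ?_
  · ext i j
    simp [secondMoment, mul_comm]
  · rw [star_trivial, dotProduct_secondMoment_mulVec hν]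
    exact integral_nonneg fun x => sq_nonneg _

theorem charFun_centeredNormal (hν : Integrable (fun x => ‖x‖ ^ 2) ν)
    (t : EuclideanSpace ℝ (Fin d)) :
    charFun (centeredNormal (secondMoment ν) : Measure (EuclideanSpace ℝ (Fin d))) t =
      Complex.exp (-((∫ x, (inner ℝ x t) ^ 2 ∂ν : ℝ) : ℂ) / 2) := by
  rw [centeredNormal, ProbabilityMeasure.coe_mk,
    charFun_multivariateGaussian (posSemidef_secondMoment hν), dotProduct_secondMoment_mulVec hν]
  simp [neg_div]

end Gaussian

/-! ### From one-dimensional projections to weak convergence -/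

section Projection

variable {Ω : Type*} [MeasurableSpace Ω] {P : Measure Ω} {d : ℕ} {T : Ω → GrowingTree}
  {ν : Measure (EuclideanSpace ℝ (Fin d))} {η : ℕ → Ω → EuclideanSpace ℝ (Fin d)}

theorem IsOffsetFamily.inner_right (hη : IsOffsetFamily P ν T η) (t : EuclideanSpace ℝ (Fin d)) :
    IsOffsetFamily P (ν.map fun x => inner ℝ x t) T (fun v ω => inner ℝ (η v ω) t) where
  measurable v := (hη.measurable v).inner_const
  law v := by
    rw [← hη.law v, Measure.map_map (by fun_prop) (hη.measurable v)]
    rfl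
  indep := hη.indep.comp (fun _ x => inner ℝ x t) fun _ => by fun_prop
  indep_tree := hη.indep_tree.comp (φ := id)
    (ψ := fun (f : ℕ → EuclideanSpace ℝ (Fin d)) v => inner ℝ (f v) t) measurable_id
    (by fun_prop)

theorem inner_position (p : GrowingTree) (y : ℕ → EuclideanSpace ℝ (Fin d))
    (t : EuclideanSpace ℝ (Fin d)) (v : ℕ) :
    inner ℝ (position p y v) t = position p (fun v => inner ℝ (y v) t) v := by
  have h := map_position (innerSL ℝ t : EuclideanSpace ℝ (Fin d) →L[ℝ] ℝ).toLinearMap.toAddMonoidHom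
    p y v
  simp only [LinearMap.toAddMonoidHom_coe, ContinuousLinearMap.coe_coe, innerSL_apply_apply] at h
  simpa only [real_inner_comm] using h

variable [IsProbabilityMeasure P] [IsProbabilityMeasure ν] {ρ : ℝ}

theorem ae_tendsto_charFun (hρ : 0 < ρ) (hT : IsWeightedRRT P ρ T)
    (hη : IsOffsetFamily P ν T η) (hν : Integrable (fun x => ‖x‖ ^ 2) ν)
    (t : EuclideanSpace ℝ (Fin d)) :
    ∀ᵐ ω ∂P, Tendsto (fun n : ℕ => charFun
        (rescale (√(Real.log n)) (Real.log n • mean ν)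
          (weightedEmpirical ρ hρ (position (T ω) (fun v => η v ω)) n) :
          Measure (EuclideanSpace ℝ (Fin d))) t) atTop
      (𝓝 (charFun (centeredNormal (secondMoment ν) : Measure (EuclideanSpace ℝ (Fin d))) t)) := by
  have hid : MemLp id 2 ν := (memLp_two_iff_integrable_sq_norm (by fun_prop)).2 hν
  have hm : Measurable fun x : EuclideanSpace ℝ (Fin d) => inner ℝ x t := by fun_prop
  have : IsProbabilityMeasure (ν.map fun x => inner ℝ x t) :=
    Measure.isProbabilityMeasure_map hm.aemeasurable
  have hL : MemLp id 2 (ν.map fun x => inner ℝ x t) := by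
    rw [memLp_map_measure_iff (by fun_prop) hm.aemeasurable]
    exact hid.inner_const t
  have h1 : ∫ x, x ∂(ν.map fun x => inner ℝ x t) = inner ℝ (mean ν) t := by
    have hi : Integrable (fun x => x) ν := hid.integrable (by norm_num)
    rw [integral_map hm.aemeasurable (by fun_prop), mean, real_inner_comm, ← integral_inner hi]
    exact integral_congr_ae (.of_forall fun x => real_inner_comm _ _)
  have h2 : ∫ x, x ^ 2 ∂(ν.map fun x => inner ℝ x t) = ∫ x, (inner ℝ x t) ^ 2 ∂ν := by
    rw [integral_map hm.aemeasurable (by fun_prop)]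
  have h := ae_tendsto_expSum hρ hT (hη.inner_right t) hL
  rw [h1, h2] at h
  filter_upwards [h] with ω hω
  rw [charFun_centeredNormal hν]
  refine hω.congr fun n => ?_
  rw [charFun_rescale_weightedEmpirical]
  simp only [walk, inner_position]

theorem ae_tendsto_rescale_weightedEmpirical (hρ : 0 < ρ) (hT : IsWeightedRRT P ρ T)
    (hη : IsOffsetFamily P ν T η) (hν : Integrable (fun x => ‖x‖ ^ 2) ν) :
    ∀ᵐ ω ∂P, Tendsto (fun n : ℕ => rescale (√(Real.log n)) (Real.log n • mean ν)
        (weightedEmpirical ρ hρ (position (T ω) (fun v => η v ω)) n)) atTop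
      (𝓝 (centeredNormal (secondMoment ν))) := by
  have hTm := hT.measurable
  have hx (v : ℕ) : Measurable fun ω => position (T ω) (fun v => η v ω) v :=
    measurable_position (fun i _ => by fun_prop) (fun i _ => hη.measurable i) le_rfl
  have hmeas : MeasurableSet {p : Ω × EuclideanSpace ℝ (Fin d) | Tendsto (fun n : ℕ => charFun
        (rescale (√(Real.log n)) (Real.log n • mean ν)
          (weightedEmpirical ρ hρ (position (T p.1) (fun v => η v p.1)) n) :
          Measure (EuclideanSpace ℝ (Fin d))) p.2) atTop
      (𝓝 (charFun (centeredNormal (secondMoment ν) :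
        Measure (EuclideanSpace ℝ (Fin d))) p.2))} := by
    refine measurableSet_tendsto_fun (fun n => ?_)
      ((measurable_charFun (μ := (centeredNormal (secondMoment ν) :
        Measure (EuclideanSpace ℝ (Fin d))))).comp measurable_snd)
    simp only [charFun_rescale_weightedEmpirical, expSum]
    have hi (v : ℕ) : Measurable fun p : Ω × EuclideanSpace ℝ (Fin d) =>
        (inner ℝ (position (T p.1) (fun v => η v p.1) v) p.2 : ℝ) :=
      ((hx v).comp measurable_fst).inner measurable_snd
    fun_prop
  -- For each `t` convergence holds almost surely; joint measurability of the convergence set lets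
  -- Fubini exchange the quantifiers, at the price of an exceptional null set of `t`.
  have h := (Measure.ae_ae_comm (μ := P) (ν := (volume : Measure (EuclideanSpace ℝ (Fin d))))
    hmeas).2 (.of_forall fun t => ae_tendsto_charFun hρ hT hη hν t)
  filter_upwards [h] with ω hω
  exact ProbabilityMeasure.tendsto_of_tendsto_charFun (tendsto_charFun_of_ae hω)

end Projection

/-! ### The uniform tree as the case of root weight one -/

section Uniform

variable {Ω : Type*} [MeasurableSpace Ω] {P : Measure Ω} {T : Ω → GrowingTree}

theorem IsRRT.isWeightedRRT (hT : IsRRT P T) : IsWeightedRRT P 1 T where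
  measurable := hT.measurable
  attach t n k := by
    rw [hT.attach, totalWeight_eq]
    simp [nodeWeight]

theorem weightedEmpirical_one {E : Type*} [MeasurableSpace E] (x : ℕ → E) (n : ℕ) :
    weightedEmpirical 1 one_pos x n = empirical x n := by
  apply Subtype.ext
  simp only [weightedEmpirical, empirical, totalWeight_eq, nodeWeight, ite_self,
    ENNReal.ofReal_one, one_smul]
  congr 2
  rw [ENNReal.ofReal_add (by positivity) zero_le_one]
  simp

end Uniform

end RecTree

end

theorem theorem6p1 {Ω : Type*} [MeasurableSpace Ω] (P : Measure Ω) [IsProbabilityMeasure P]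
    (d : ℕ) (ν : Measure (EuclideanSpace ℝ (Fin d))) [IsProbabilityMeasure ν]
    (hν : Integrable (fun x => ‖x‖ ^ 2) ν)
    (T : Ω → RecTree.GrowingTree) (η : ℕ → Ω → EuclideanSpace ℝ (Fin d))
    (hη : RecTree.IsOffsetFamily P ν T η) :
    (RecTree.IsRRT P T →
      ∀ᵐ ω ∂P, Tendsto
        (fun n : ℕ => RecTree.rescale (Real.sqrt (Real.log n)) (Real.log n • RecTree.mean ν)
          (RecTree.empirical (RecTree.position (T ω) (fun v => η v ω)) n))
        atTop (𝓝 (RecTree.centeredNormal (RecTree.secondMoment ν)))) ∧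
    (∀ (ρ : ℝ) (hρ : 0 < ρ), RecTree.IsWeightedRRT P ρ T →
      ∀ᵐ ω ∂P, Tendsto
        (fun n : ℕ => RecTree.rescale (Real.sqrt (Real.log n)) (Real.log n • RecTree.mean ν)
          (RecTree.weightedEmpirical ρ hρ (RecTree.position (T ω) (fun v => η v ω)) n))
        atTop (𝓝 (RecTree.centeredNormal (RecTree.secondMoment ν)))) := by
  refine ⟨fun hT => ?_, fun ρ hρ hT =>
    RecTree.ae_tendsto_rescale_weightedEmpirical hρ hT hη hν⟩
  simpa only [RecTree.weightedEmpirical_one] using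
    RecTree.ae_tendsto_rescale_weightedEmpirical one_pos hT.isWeightedRRT hη hν
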